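/- Let $\kappa(x,y)=\min(x(1-y),\,y(1-x))$ and $(Kf)(x)=\int_0^1\kappa(x,y)f(y)\,dy$ for $f\in L^2(0,1)$ (real-valued). For an integer $n\ge1$ put $\xi_{l,n}=l/(n+1)$, $l=1,\dots,n$, and let $K_n:L^2(0,1)\to\mathbb R^n$, $K_nf=((Kf)(\xi_{l,n}))_{l=1}^n$, have the singular value decomposition $(v_{j,n},u_{j,n},\sigma_{j,n})_{j=1}^n$: $\sigma_{1,n}\ge\dots\ge\sigma_{n,n}>0$, $(v_{j,n})_j$ and $(u_{j,n})_j$ are orthonormal bases of $\mathcal N(K_n)^\perp$ and $\mathbb R^n$, $K_nv_{j,n}=\sigma_{j,n}u_{j,n}$ and $K_n^*u_{j,n}=\sigma_{j,n}v_{j,n}$. For $s,\rho>0$ let $$\mathcal X_{s,\rho}=\{(K^*K)^{s/2}h : h\in L^2(0,1),\ \|h\|\le\rho\}.$$ Let $m\ge1$ be an integer, $\delta>0$, $\rho>0$, $s>3/4$, and let $Z_1,\dots,Z_m$ be i.i.d. real random variables with $\mathbb E Z_l=0$ and $\mathbb E Z_l^2=1$. For $f\in L^2(0,1)$ let $g_m^\delta\in\mathbb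 R^m$ be the noisy data $(g_m^\delta)_l=(Kf)(\xi_{l,m})+\delta Z_l$, and for a positive integer $o$ dividing $m$ and $m_o=m/o$ let $\overline g^\delta_{m_o}\in\mathbb R^{m_o}$ be the averaged data $(\overline g^\delta_{m_o})_i=\frac1o\sum_{j=1}^{o}(g_m^\delta)_{(i-1)o+j}$. Define the spectral cut-off estimators $$f^\delta_{k,m}=\sum_{j=1}^k\frac{(g^\delta_m,u_{j,m})}{\sigma_{j,m}}v_{j,m},\qquad \overline f^\delta_{k,m_o}=\sum_{j=1}^k\frac{(\overline g^\delta_{m_o},u_{j,m_o})}{\sigma_{j,m_o}}v_{j,m_o}$$ and the minimax errors $$\mathrm{err}(\delta,m,s,\rho)=\min_{0\le k\le m}\ \sup_{f\in\mathcal X_{s,\rho}}\mathbb E\|f^\delta_{k,m}-f\|^2,\qquad \overline{\mathrm{err}}(\delta,m_o,s,\rho)=\min_{0\le k\le m_o}\ \sup_{f\in\mathcal X_{s,\rho}}\mathbb E\|\overline f^\delta_{k,m_o}-f\|^2 .$$ Then, for every positive integer $o$ that divides $m$ and satisfies $o\le\max\left(\sqrt{(m+1)\delta^2/\rho^2},\,1\right)$,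 $$c\cdot\mathrm{err}(\delta,m,s,\rho)\ \le\ \overline{\mathrm{err}}(\delta,m_o,s,\rho)\ \le\ C\cdot\mathrm{err}(\delta,m,s,\rho),\qquad c=\frac{16}{\pi^{4s+4}(3\pi^4+1/2)},\quad C=\frac{15\,\pi^{4s+8}}{16}.$$ -/

import Mathlib

open MeasureTheory ProbabilityTheory Set
open scoped ENNReal InnerProductSpace

noncomputable section

namespace AveragedData

/-- The real Hilbert space `L²(0,1)`. -/
abbrev L2 : Type := Lp ℝ 2 (volume.restrict (Ioo (0 : ℝ) 1))

/-- The kernel `κ(x,y) = min (x(1-y), y(1-x))`. -/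
def kappa (x y : ℝ) : ℝ := min (x * (1 - y)) (y * (1 - x))

/-- The function `(Kf)(x) = ∫₀¹ κ(x,y) f(y) dy`, defined for every `x`. -/
def Kfun (f : L2) (x : ℝ) : ℝ := ∫ y in Ioo (0 : ℝ) 1, kappa x y * f y

theorem continuous_kappa : Continuous (fun p : ℝ × ℝ => kappa p.1 p.2) := by
  unfold kappa; fun_prop

theorem abs_kappa_le {x y : ℝ} (hx : x ∈ Icc (0 : ℝ) 1) (hy : y ∈ Icc (0 : ℝ) 1) :
    |kappa x y| ≤ 1 := by
  obtain ⟨hx0, hx1⟩ := hx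
  obtain ⟨hy0, hy1⟩ := hy
  have h1 : 0 ≤ x * (1 - y) := mul_nonneg hx0 (by linarith)
  have h2 : 0 ≤ y * (1 - x) := mul_nonneg hy0 (by linarith)
  unfold kappa
  rw [abs_of_nonneg (le_min h1 h2)]
  exact (min_le_left _ _).trans (by nlinarith)

theorem memLp_kappa (x : ℝ) :
    MemLp (kappa x) 2 (volume.restrict (Ioo (0 : ℝ) 1)) := by
  have hc : Continuous (kappa x) := by unfold kappa; fun_prop
  obtain ⟨C, hC⟩ := (isCompact_Icc (a := (0 : ℝ)) (b := 1)).exists_bound_of_continuousOn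
    hc.continuousOn
  refine MemLp.of_bound hc.aestronglyMeasurable C ?_
  exact (ae_restrict_iff' measurableSet_Ioo).2
    (Filter.Eventually.of_forall fun y hy => hC y (Ioo_subset_Icc_self hy))

/-- The section `κ(x,·)` as an element of `L²(0,1)`. -/
def kappaL2 (x : ℝ) : L2 := (memLp_kappa x).toLp (kappa x)

theorem Kfun_eq_inner (f : L2) (x : ℝ) : Kfun f x = ⟪kappaL2 x, f⟫_ℝ := by
  rw [L2.inner_def]
  refine integral_congr_ae ?_
  filter_upwards [(memLp_kappa x).coeFn_toLp] with y hy
  simp only [kappaL2, hy]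
  simp [mul_comm]

theorem norm_kappaL2_le {x : ℝ} (hx : x ∈ Icc (0 : ℝ) 1) : ‖kappaL2 x‖ ≤ 1 := by
  have h := Lp.norm_le_of_ae_bound (f := kappaL2 x) (C := 1) zero_le_one (by
    filter_upwards [(memLp_kappa x).coeFn_toLp, ae_restrict_mem measurableSet_Ioo] with y hy hy'
    rw [kappaL2, hy]
    exact abs_kappa_le hx (Ioo_subset_Icc_self hy'))
  simpa [measureUnivNNReal] using h

theorem abs_Kfun_le (f : L2) {x : ℝ} (hx : x ∈ Icc (0 : ℝ) 1) : |Kfun f x| ≤ ‖f‖ := by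
  rw [Kfun_eq_inner]
  exact (abs_real_inner_le_norm _ _).trans
    (mul_le_of_le_one_left (norm_nonneg _) (norm_kappaL2_le hx))

theorem memLp_Kfun (f : L2) :
    MemLp (Kfun f) 2 (volume.restrict (Ioo (0 : ℝ) 1)) := by
  refine MemLp.of_bound ?_ ‖f‖ ?_
  · have h : StronglyMeasurable (fun p : ℝ × ℝ => kappa p.1 p.2 * f p.2) :=
      continuous_kappa.stronglyMeasurable.mul
        ((Lp.stronglyMeasurable f).comp_measurable measurable_snd)
    exact (h.integral_prod_right (ν := volume.restrict (Ioo (0 : ℝ) 1))).aestronglyMeasurable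
  · filter_upwards [ae_restrict_mem measurableSet_Ioo] with y hy
    exact abs_Kfun_le f (Ioo_subset_Icc_self hy)

theorem Kfun_add (f g : L2) : Kfun (f + g) = Kfun f + Kfun g := by
  funext x; simp [Kfun_eq_inner, inner_add_right]

theorem Kfun_smul (c : ℝ) (f : L2) : Kfun (c • f) = c • Kfun f := by
  funext x; simp [Kfun_eq_inner, inner_smul_right]

/-- The integral operator `K : L²(0,1) → L²(0,1)` with kernel `κ`. -/
def K : L2 →L[ℝ] L2 :=
  LinearMap.mkContinuous
    { toFun := fun f => (memLp_Kfun f).toLp (Kfun f)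
      map_add' := fun f g => by
        rw [← MemLp.toLp_add (memLp_Kfun f) (memLp_Kfun g)]
        exact MemLp.toLp_congr _ _ (by rw [Kfun_add])
      map_smul' := fun c f => by
        rw [RingHom.id_apply, ← MemLp.toLp_const_smul c (memLp_Kfun f)]
        exact MemLp.toLp_congr _ _ (by rw [Kfun_smul]) }
    1 (fun f => by
      have h := Lp.norm_le_of_ae_bound (f := (memLp_Kfun f).toLp (Kfun f)) (norm_nonneg f) (by
        filter_upwards [(memLp_Kfun f).coeFn_toLp, ae_restrict_mem measurableSet_Ioo] with y hy hy'
        rw [hy]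
        exact abs_Kfun_le f (Ioo_subset_Icc_self hy'))
      simpa [measureUnivNNReal] using h)

/-- The uniform grid `ξ_{l,n} = l/(n+1)`, `l = 1,…,n`, the index `l` being shifted to start at
`0`. -/
def grid (n : ℕ) (l : Fin n) : ℝ := ((l : ℝ) + 1) / ((n : ℝ) + 1)

theorem grid_mem {n : ℕ} (l : Fin n) : grid n l ∈ Icc (0 : ℝ) 1 := by
  have h : ((l : ℕ) : ℝ) < n := by exact_mod_cast l.2
  have h0 : (0 : ℝ) ≤ (l : ℕ) := Nat.cast_nonneg _
  unfold grid
  exact ⟨by positivity, by rw [div_le_one (by positivity)]; linarith⟩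

/-- The semi-discrete operator `K_n : L²(0,1) → ℝⁿ`, `f ↦ ((Kf)(ξ_{l,n}))_l`, where `ℝⁿ` carries
the Euclidean inner product. -/
def Km (n : ℕ) : L2 →L[ℝ] EuclideanSpace ℝ (Fin n) :=
  (PiLp.continuousLinearEquiv 2 ℝ (fun _ : Fin n => ℝ)).symm.toContinuousLinearMap ∘L
    ContinuousLinearMap.pi fun l =>
      LinearMap.mkContinuous
        { toFun := fun f => Kfun f (grid n l)
          map_add' := fun f g => by rw [Kfun_add]; rfl
          map_smul' := fun c f => by rw [Kfun_smul]; rfl }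
        1 (fun f => by simpa using abs_Kfun_le f (grid_mem l))

theorem Km_apply (n : ℕ) (f : L2) (l : Fin n) : Km n f l = Kfun f (grid n l) := rfl

theorem K_ae (f : L2) : K f =ᵐ[volume.restrict (Ioo (0 : ℝ) 1)] Kfun f :=
  (memLp_Kfun f).coeFn_toLp

/-- `f = φ(T) h` for a compact self-adjoint operator `T`, i.e. `f = ∑_μ φ(μ) P_μ h`, where `μ` runs
through the eigenvalues of `T` and `P_μ` is the orthogonal projection onto the eigenspace of `μ`. -/
def IsSpectralFunction (T : L2 →L[ℝ] L2) (φ : ℝ → ℝ) (h f : L2) : Prop :=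
  HasSum (fun μ : Module.End.Eigenvalues (T : Module.End ℝ L2) =>
    φ μ • (Module.End.eigenspace (T : Module.End ℝ L2) (μ : ℝ)).starProjection h) f

/-- The source set `X_{s,ρ} = {φ_s(K*K) h : h ∈ L²(0,1), ‖h‖ ≤ ρ}` with `φ_s(t) = t^{s/2}`. -/
def sourceSet (s ρ : ℝ) : Set L2 :=
  {f | ∃ h : L2, ‖h‖ ≤ ρ ∧
    IsSpectralFunction (ContinuousLinearMap.adjoint K ∘L K) (fun t => t ^ (s / 2)) h f}

/-- `(v_j, u_j, σ_j)_{j < n}` is a singular value decomposition of the operator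
`A : L²(0,1) → ℝⁿ` of full rank `n`. -/
structure IsSVD {n : ℕ} (A : L2 →L[ℝ] EuclideanSpace ℝ (Fin n)) (v : Fin n → L2)
    (u : Fin n → EuclideanSpace ℝ (Fin n)) (σ : Fin n → ℝ) : Prop where
  antitone : Antitone σ
  pos : ∀ j, 0 < σ j
  orthonormal_v : Orthonormal ℝ v
  span_v : Submodule.span ℝ (range v) = (LinearMap.ker (A : L2 →ₗ[ℝ] EuclideanSpace ℝ (Fin n)))ᗮ
  orthonormal_u : Orthonormal ℝ u
  span_u : Submodule.span ℝ (range u) = ⊤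
  apply_v : ∀ j, A (v j) = σ j • u j
  adjoint_apply_u : ∀ j, ContinuousLinearMap.adjoint A (u j) = σ j • v j

/-- An operator `L²(0,1) → ℝⁿ` with injective adjoint has a singular value decomposition. -/
theorem exists_isSVD {n : ℕ} (A : L2 →L[ℝ] EuclideanSpace ℝ (Fin n))
    (hA : Function.Injective (ContinuousLinearMap.adjoint A)) :
    ∃ v u σ, IsSVD A v u σ := by
  set B := ContinuousLinearMap.adjoint A with hB
  have hadj : ∀ f y, ⟪A f, y⟫_ℝ = ⟪f, B y⟫_ℝ := fun f y =>
    (ContinuousLinearMap.adjoint_inner_right A f y).symm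
  let T : EuclideanSpace ℝ (Fin n) →ₗ[ℝ] EuclideanSpace ℝ (Fin n) := (A ∘L B).toLinearMap
  have hTin : ∀ x y, ⟪T x, y⟫_ℝ = ⟪B x, B y⟫_ℝ := fun x y => hadj (B x) y
  have hT : T.IsSymmetric := by
    intro x y
    rw [hTin, real_inner_comm (T y) x, hTin, real_inner_comm]
  have hn : Module.finrank ℝ (EuclideanSpace ℝ (Fin n)) = n := by simp
  let u := hT.eigenvectorBasis hn
  let l := hT.eigenvalues hn
  have hTu : ∀ j, T (u j) = l j • u j := fun j => hT.apply_eigenvectorBasis hn j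
  have hBB : ∀ i j, ⟪B (u i), B (u j)⟫_ℝ = l i * if i = j then 1 else 0 := by
    intro i j
    rw [← hTin, hTu, inner_smul_left, orthonormal_iff_ite.1 u.orthonormal i j]
    simp
  have hl : ∀ j, 0 < l j := by
    intro j
    have h := hBB j j
    rw [if_pos rfl, mul_one] at h
    rw [← h, real_inner_self_pos]
    intro h0
    exact u.orthonormal.ne_zero j (hA (h0.trans (map_zero B).symm))
  let σ : Fin n → ℝ := fun j => Real.sqrt (l j)
  have hσ : ∀ j, 0 < σ j := fun j => Real.sqrt_pos.2 (hl j)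
  have hσ2 : ∀ j, σ j * σ j = l j := fun j => Real.mul_self_sqrt (hl j).le
  have hBv : ∀ j, B (u j) = σ j • ((σ j)⁻¹ • B (u j)) := fun j => by
    rw [smul_smul, mul_inv_cancel₀ (hσ j).ne', one_smul]
  refine ⟨fun j => (σ j)⁻¹ • B (u j), u, σ, ?_, hσ, ?_, ?_, u.orthonormal, ?_, ?_, hBv⟩
  · exact fun i j hij => Real.sqrt_le_sqrt (hT.eigenvalues_antitone hn hij)
  · rw [orthonormal_iff_ite]
    intro i j
    rw [inner_smul_left, inner_smul_right, hBB]
    by_cases h : i = j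
    · subst h
      have := (hσ i).ne'
      simp [← hσ2, this]
    · simp [h]
  · have h1 : (LinearMap.ker (A : L2 →ₗ[ℝ] EuclideanSpace ℝ (Fin n)))ᗮ =
        LinearMap.range (B : EuclideanSpace ℝ (Fin n) →ₗ[ℝ] L2) := by
      have h2 := ContinuousLinearMap.orthogonal_range (B)
      rw [hB, ContinuousLinearMap.adjoint_adjoint] at h2
      have h3 : LinearMap.ker (A : L2 →ₗ[ℝ] EuclideanSpace ℝ (Fin n)) =
        (LinearMap.range (B : EuclideanSpace ℝ (Fin n) →ₗ[ℝ] L2))ᗮ := h2.symm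
      rw [h3, Submodule.orthogonal_orthogonal]
    rw [h1, LinearMap.range_eq_map, ← u.toBasis.span_eq, Submodule.map_span, ← range_comp]
    apply le_antisymm
    · rw [Submodule.span_le]
      rintro _ ⟨j, rfl⟩
      exact Submodule.smul_mem _ _ (Submodule.subset_span ⟨j, by simp⟩)
    · rw [Submodule.span_le]
      rintro _ ⟨j, rfl⟩
      have : ((B : EuclideanSpace ℝ (Fin n) →ₗ[ℝ] L2) ∘ u.toBasis) j =
        σ j • ((σ j)⁻¹ • B (u j)) := by rw [← hBv]; simp
      rw [this]
      exact Submodule.smul_mem _ _ (Submodule.subset_span ⟨j, rfl⟩)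
  · simpa using u.toBasis.span_eq
  · intro j
    have h := hTu j
    rw [map_smul]
    change (σ j)⁻¹ • T (u j) = _
    have := (hσ j).ne'
    rw [h, smul_smul, ← hσ2]
    congr 1
    field_simp

theorem kappa_eq (x y : ℝ) : kappa x y = min x y - x * y := by
  unfold kappa
  rcases le_total x y with h | h
  · rw [min_eq_left h, min_eq_left (by nlinarith)]; ring
  · rw [min_eq_right h, min_eq_right (by nlinarith)]; ring

theorem adjoint_Km_apply (n : ℕ) (y : EuclideanSpace ℝ (Fin n)) :
    ContinuousLinearMap.adjoint (Km n) y = ∑ l, y l • kappaL2 (grid n l) := by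
  refine ext_inner_right ℝ fun f => ?_
  rw [ContinuousLinearMap.adjoint_inner_left, sum_inner, PiLp.inner_apply]
  refine Finset.sum_congr rfl fun l _ => ?_
  rw [Km_apply, Kfun_eq_inner, inner_smul_left]
  simp [mul_comm]

theorem adjoint_Km_injective (n : ℕ) :
    Function.Injective (ContinuousLinearMap.adjoint (Km n)) := by
  rw [injective_iff_map_eq_zero]
  intro y hy
  rw [adjoint_Km_apply] at hy
  let F : ℝ → ℝ := fun t => ∑ l, y l * kappa (grid n l) t
  have hFc : Continuous F := by
    unfold F kappa; fun_prop
  have hF : ∀ t ∈ Ioo (0 : ℝ) 1, F t = 0 := by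
    have hae : F =ᵐ[volume.restrict (Ioo (0 : ℝ) 1)] fun _ => 0 := by
      have h1 : (fun t => ∑ l, (y l • kappaL2 (grid n l) : L2) t)
          =ᵐ[volume.restrict (Ioo (0 : ℝ) 1)] F := by
        have h2 : ∀ᵐ t ∂volume.restrict (Ioo (0 : ℝ) 1), ∀ l,
            (y l • kappaL2 (grid n l) : L2) t = y l * kappa (grid n l) t := by
          rw [ae_all_iff]
          intro l
          filter_upwards [Lp.coeFn_smul (y l) (kappaL2 (grid n l)),
            (memLp_kappa (grid n l)).coeFn_toLp] with t h3 h4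
          rw [h3, Pi.smul_apply, kappaL2, h4, smul_eq_mul]
        filter_upwards [h2] with t ht
        exact Finset.sum_congr rfl fun l _ => ht l
      have h5 := Lp.coeFn_zero ℝ 2 (volume.restrict (Ioo (0 : ℝ) 1))
      rw [← hy] at h5
      have h6 := Lp.coeFn_finsetSum Finset.univ (fun l => (y l • kappaL2 (grid n l) : L2))
      filter_upwards [h1, h5, h6] with t h1 h5 h6
      rw [← h1]
      rw [h6] at h5
      simpa using h5
    exact fun t ht => Measure.eqOn_open_of_ae_eq hae isOpen_Ioo hFc.continuousOn
      continuousOn_const ht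
  ext i
  have hN : (0 : ℝ) < (n : ℝ) + 1 := by positivity
  set e : ℝ := 1 / (2 * ((n : ℝ) + 1)) with he
  have he0 : 0 < e := by positivity
  have hg : ∀ l : Fin n, grid n l = 2 * e * ((l : ℕ) + 1) := fun l => by
    rw [grid, he]; field_simp
  have hin : ((i : ℕ) : ℝ) + 1 ≤ n := by exact_mod_cast i.2
  have h1e : 2 * e * ((n : ℝ) + 1) = 1 := by rw [he]; field_simp
  have hi0 : (0 : ℝ) ≤ ((i : ℕ) : ℝ) := Nat.cast_nonneg _
  have ha := hF (grid n i + e) ⟨by rw [hg]; positivity, by rw [hg]; nlinarith⟩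
  have hb := hF (grid n i - e) ⟨by rw [hg]; nlinarith, by rw [hg]; nlinarith⟩
  have hc := hF (grid n i) ⟨by rw [hg]; positivity, by rw [hg]; nlinarith⟩
  have hsum : F (grid n i + e) + F (grid n i - e) - 2 * F (grid n i) = -e * y i := by
    have : F (grid n i + e) + F (grid n i - e) - 2 * F (grid n i) =
        ∑ l, y l * (kappa (grid n l) (grid n i + e) + kappa (grid n l) (grid n i - e)
          - 2 * kappa (grid n l) (grid n i)) := by
      simp only [F, Finset.mul_sum, ← Finset.sum_add_distrib, ← Finset.sum_sub_distrib]
      exact Finset.sum_congr rfl fun l _ => by ring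
    rw [this, Finset.sum_eq_single i]
    · rw [kappa_eq, kappa_eq, kappa_eq, min_eq_left (by linarith), min_eq_right (by linarith),
        min_self]
      ring
    · intro l _ hl
      rcases lt_or_gt_of_ne hl with h | h
      · have h' : ((l : ℕ) : ℝ) + 1 ≤ (i : ℕ) := by exact_mod_cast h
        have hle : grid n l ≤ grid n i - e := by rw [hg, hg]; nlinarith
        rw [kappa_eq, kappa_eq, kappa_eq, min_eq_left (by linarith), min_eq_left hle,
          min_eq_left (by linarith)]
        ring
      · have h' : ((i : ℕ) : ℝ) + 1 ≤ (l : ℕ) := by exact_mod_cast h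
        have hle : grid n i + e ≤ grid n l := by rw [hg, hg]; nlinarith
        rw [kappa_eq, kappa_eq, kappa_eq, min_eq_right hle, min_eq_right (by linarith),
          min_eq_right (by linarith)]
        ring
    · simp
  rw [ha, hb, hc] at hsum
  have : e * y i = 0 := by linarith
  simpa [he0.ne'] using this

/-- The semi-discrete operators possess a singular value decomposition. -/
theorem exists_isSVD_Km (n : ℕ) : ∃ v u σ, IsSVD (Km n) v u σ :=
  exists_isSVD (Km n) (adjoint_Km_injective n)

/-- The spectral cut-off reconstruction `∑_{j=1}^k (y, u_j) / σ_j · v_j` from the data `y ∈ ℝⁿ`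
(indices shifted to start at `0`). -/
def spectralCutoff {n : ℕ} (v : Fin n → L2) (u : Fin n → EuclideanSpace ℝ (Fin n))
    (σ : Fin n → ℝ) (k : ℕ) (y : EuclideanSpace ℝ (Fin n)) : L2 :=
  ∑ j ∈ Finset.univ.filter (fun j : Fin n => (j : ℕ) < k), (⟪y, u j⟫_ℝ / σ j) • v j

/-- The noisy point evaluations `(g(ξ_{l,m}) + δ z_l)_l` of `g = Kf`, where `z` is the realization
of the noise. -/
def noisyData (m : ℕ) (δ : ℝ) (f : L2) (z : Fin m → ℝ) : EuclideanSpace ℝ (Fin m) :=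
  WithLp.toLp 2 fun l => Kfun f (grid m l) + δ * z l

/-- The averages of `y ∈ ℝᵐ` over the consecutive blocks of length `o`. -/
def blockAverage {m : ℕ} (o : ℕ) (y : EuclideanSpace ℝ (Fin m)) :
    EuclideanSpace ℝ (Fin (m / o)) :=
  WithLp.toLp 2 fun i =>
    (∑ j : Fin o, y ⟨(i : ℕ) * o + j, calc
      (i : ℕ) * o + j < (i : ℕ) * o + o := Nat.add_lt_add_left j.2 _
      _ = ((i : ℕ) + 1) * o := by ring
      _ ≤ m / o * o := Nat.mul_le_mul_right _ i.2
      _ ≤ m := Nat.div_mul_le_self m o⟩) / o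

/-- The minimax error `min_{k = 0,…,m} sup_{f ∈ X_{s,ρ}} E ‖f^δ_{k,m} - f‖²` of the spectral
cut-off estimator built from `m` noisy point evaluations. -/
def err {Ω : Type*} [MeasurableSpace Ω] (P : Measure Ω) {m : ℕ} (Z : Fin m → Ω → ℝ)
    (v : Fin m → L2) (u : Fin m → EuclideanSpace ℝ (Fin m)) (σ : Fin m → ℝ)
    (δ s ρ : ℝ) : ℝ≥0∞ :=
  ⨅ k : Fin (m + 1), ⨆ f ∈ sourceSet s ρ,
    ∫⁻ ω, ‖spectralCutoff v u σ k (noisyData m δ f fun l => Z l ω) - f‖ₑ ^ 2 ∂P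

/-- The minimax error `min_{k = 0,…,m/o} sup_{f ∈ X_{s,ρ}} E ‖f̄^δ_{k,m/o} - f‖²` of the spectral
cut-off estimator built from the averages of the `m` noisy point evaluations over blocks of
length `o`. -/
def errAveraged {Ω : Type*} [MeasurableSpace Ω] (P : Measure Ω) {m : ℕ} (Z : Fin m → Ω → ℝ)
    (o : ℕ) (v : Fin (m / o) → L2) (u : Fin (m / o) → EuclideanSpace ℝ (Fin (m / o)))
    (σ : Fin (m / o) → ℝ) (δ s ρ : ℝ) : ℝ≥0∞ :=
  ⨅ k : Fin (m / o + 1), ⨆ f ∈ sourceSet s ρ,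
    ∫⁻ ω, ‖spectralCutoff v u σ k (blockAverage o (noisyData m δ f fun l => Z l ω)) - f‖ₑ ^ 2 ∂P

/-- The admissible block lengths. -/
def admissibleBlocks (m : ℕ) (δ ρ : ℝ) : Set ℕ :=
  {o | (o : ℝ) ≤ max (Real.sqrt (((m : ℝ) + 1) * δ ^ 2 / ρ ^ 2)) 1 ∧ o ∣ m}

end AveragedData

end

/-! `K` is diagonal in the sines √2 sin((j+1)πx), with eigenvalues λ_j = ((j+1)π)⁻² (Mercer,
`hasSum_kappa`). On the uniform grid, sines whose wave numbers agree up to sign modulo 2(n+1)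
coincide up to sign. Hence K_n K_n^* is diagonal in the sampled sines, with eigenvalues n+1 times
the sums of λ² over alias classes (`Km_adjVec`). These are simple, so every singular value
decomposition is this one up to signs (`IsSVD.exists_sign`), and the risk can be computed
explicitly.

The risk of the cut-off at k is tail + noise, plus a bias for averaged data. The worst tail over the
source set is at least ρ²λ_k^{2s}, attained by a single sine (`tailSq_smul_sineL2`), and at most six
times that plus an alias term of order ρ²(n+1)⁻⁴ (`tailSq_le`). The j-th noise term is comparable to
(j+1)⁴/(n+1), so dividing the variance by o compensates for dividing the number of data by o
(`div_noiseAmp_le`, `noiseAmp_le_div`).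

Averaging moves sampling points by at most (o-1)/(m+1), and Kf is Lipschitz with constant ‖f‖; this
bounds the bias (`IsSVD.biasSq_avgBias_le`). For o ≥ 2 admissibility says o²ρ² ≤ (m+1)δ², which
makes both bias and alias term at most a multiple of the full-data noise (`sq_mul_le_noise`,
`sq_div_sq_le_noise`). A cut-off k > m/o is replaced by 0, since its noise already dominates ‖f‖².
The two minimax errors are thus comparable with factors 7 and 12, well inside the stated constants.
-/

namespace AveragedData

open Real Filter Topology

/-! ### Sine eigenfunctions of K and Mercer's expansion -/

/-- The angular frequency `(j+1)π` of the `j`-th Dirichlet eigenfunction. -/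
noncomputable def sineFreq (j : ℕ) : ℝ := ((j : ℝ) + 1) * π

theorem sineFreq_pos (j : ℕ) : 0 < sineFreq j := by unfold sineFreq; positivity

/-- The function `√2 sin((j+1)πx)`. -/
noncomputable def sine (j : ℕ) (x : ℝ) : ℝ := √2 * sin (sineFreq j * x)

theorem continuous_sine (j : ℕ) : Continuous (sine j) := by unfold sine; fun_prop

theorem abs_sine_le (j : ℕ) (x : ℝ) : |sine j x| ≤ √2 := by
  rw [sine, abs_mul, abs_of_nonneg (sqrt_nonneg 2)]
  exact mul_le_of_le_one_right (sqrt_nonneg 2) (abs_sin_le_one _)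

/-- The eigenvalue `((j+1)π)⁻²` of `K`. -/
noncomputable def lam (j : ℕ) : ℝ := 1 / sineFreq j ^ 2

theorem lam_pos (j : ℕ) : 0 < lam j := by
  have := sineFreq_pos j; unfold lam; positivity

theorem summable_lam : Summable lam := by
  have h := (summable_nat_add_iff 1).2 (Real.summable_one_div_nat_pow.2 (one_lt_two))
  refine (h.mul_left (1 / π ^ 2)).congr fun j => ?_
  unfold lam sineFreq
  push_cast
  field_simp

theorem memLp_sine (j : ℕ) : MemLp (sine j) 2 (volume.restrict (Ioo (0 : ℝ) 1)) :=
  MemLp.of_bound (continuous_sine j).aestronglyMeasurable (√2)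
    (Eventually.of_forall fun y => abs_sine_le j y)

/-- The function `√2 sin((j+1)πx)` as an element of `L²(0,1)`. -/
noncomputable def sineL2 (j : ℕ) : L2 := (memLp_sine j).toLp (sine j)

theorem sineL2_ae (j : ℕ) : sineL2 j =ᵐ[volume.restrict (Ioo (0 : ℝ) 1)] sine j :=
  (memLp_sine j).coeFn_toLp

theorem integral_cos_int_mul_pi {k : ℤ} (hk : k ≠ 0) :
    ∫ x in (0 : ℝ)..1, cos ((k : ℝ) * π * x) = 0 := by
  have hc : (k : ℝ) * π ≠ 0 := mul_ne_zero (by exact_mod_cast hk) pi_ne_zero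
  rw [intervalIntegral.integral_comp_mul_left (fun x => cos x) hc]
  simp [sin_int_mul_pi]

theorem orthonormal_sineL2 : Orthonormal ℝ sineL2 := by
  rw [orthonormal_iff_ite]
  intro i j
  have h1 : ⟪sineL2 i, sineL2 j⟫_ℝ = ∫ x in (0 : ℝ)..1, sine i x * sine j x := by
    rw [L2.inner_def, intervalIntegral.integral_of_le zero_le_one, integral_Ioc_eq_integral_Ioo]
    refine integral_congr_ae ?_
    filter_upwards [sineL2_ae i, sineL2_ae j] with x hi hj
    simp [hi, hj, mul_comm]
  have h2 : ∀ x, sine i x * sine j x =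
      cos (((i - j : ℤ) : ℝ) * π * x) - cos (((i + j + 2 : ℤ) : ℝ) * π * x) := fun x => by
    have h3 : (√2) ^ 2 = 2 := sq_sqrt zero_le_two
    have h4 : ((i - j : ℤ) : ℝ) * π * x = sineFreq i * x - sineFreq j * x := by
      unfold sineFreq; push_cast; ring
    have h5 : ((i + j + 2 : ℤ) : ℝ) * π * x = sineFreq i * x + sineFreq j * x := by
      unfold sineFreq; push_cast; ring
    rw [h4, h5, cos_sub, cos_add]
    unfold sine
    linear_combination sin (sineFreq i * x) * sin (sineFreq j * x) * h3
  simp only [h1, h2]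
  rw [intervalIntegral.integral_sub (by apply Continuous.intervalIntegrable; fun_prop)
    (by apply Continuous.intervalIntegrable; fun_prop),
    integral_cos_int_mul_pi (k := i + j + 2) (by omega), sub_zero]
  split_ifs with h
  · simp [h]
  · exact integral_cos_int_mul_pi (by omega)

/-- This is the Fourier series of the Bernoulli polynomial B₂, reindexed to start at wave number 1.
-/
theorem hasSum_cos_div_sq {x : ℝ} (hx : x ∈ Icc (0 : ℝ) 1) :
    HasSum (fun j : ℕ => cos (sineFreq j * (2 * x)) * lam j) (x ^ 2 - x + 1 / 6) := by
  have h := hasSum_one_div_nat_pow_mul_cos one_ne_zero hx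
  have h2 : (Polynomial.map (algebraMap ℚ ℝ) (Polynomial.bernoulli (2 * 1))).eval x =
      x ^ 2 - x + 1 / 6 := by
    simp [Polynomial.bernoulli, Finset.sum_range_succ, bernoulli_two, bernoulli_one]
    ring
  rw [h2, ← hasSum_nat_add_iff' 1] at h
  have h3 := h.mul_left (1 / π ^ 2)
  convert! h3 using 1
  · ext j
    unfold lam sineFreq
    push_cast
    rw [show ((j : ℝ) + 1) * π * (2 * x) = 2 * π * (j + 1) * x by ring]
    field_simp
  · simp [Nat.factorial]
    field_simp

/-- A product of sines is a difference of cosines, and B₂((x-y)/2) - B₂((x+y)/2) = y - xy, which is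
the kernel for y ≤ x. -/
theorem hasSum_kappa {x y : ℝ} (hx : x ∈ Icc (0 : ℝ) 1) (hy : y ∈ Icc (0 : ℝ) 1) :
    HasSum (fun j => lam j * (sine j x * sine j y)) (kappa x y) := by
  obtain ⟨hx0, hx1⟩ := hx
  obtain ⟨hy0, hy1⟩ := hy
  wlog hxy : y ≤ x generalizing x y
  · have := this hy0 hy1 hx0 hx1 (le_of_not_ge hxy)
    rw [kappa_eq] at this ⊢
    rw [min_comm, mul_comm x y]
    refine this.congr_fun ?_ |> id
    intro j; ring
  have h1 := hasSum_cos_div_sq (x := (x - y) / 2) ⟨by linarith, by linarith⟩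
  have h2 := hasSum_cos_div_sq (x := (x + y) / 2) ⟨by linarith, by linarith⟩
  convert! h1.sub h2 using 1
  · ext j
    have h3 : (√2) ^ 2 = 2 := sq_sqrt zero_le_two
    rw [show sineFreq j * (2 * ((x - y) / 2)) = sineFreq j * x - sineFreq j * y by ring,
      show sineFreq j * (2 * ((x + y) / 2)) = sineFreq j * x + sineFreq j * y by ring,
      cos_sub, cos_add]
    unfold sine
    linear_combination lam j * sin (sineFreq j * x) * sin (sineFreq j * y) * h3
  · rw [kappa_eq, min_eq_right hxy]
    ring

theorem summable_lam_mul_sine_smul (x : ℝ) :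
    Summable fun j => (lam j * sine j x) • sineL2 j := by
  refine Summable.of_norm_bounded (summable_lam.mul_right (√2)) fun j => ?_
  rw [norm_smul, orthonormal_sineL2.1 j, mul_one, norm_mul, norm_of_nonneg (lam_pos j).le]
  exact mul_le_mul_of_nonneg_left (abs_sine_le j x) (lam_pos j).le

/-- The pointwise remainder is bounded uniformly in y, and (0,1) has measure 1. This identifies the
L² limit of the series without completeness of the sines. -/
theorem norm_kappaL2_sub_sum_le {x : ℝ} (hx : x ∈ Icc (0 : ℝ) 1) (n : ℕ) :
    ‖∑ j ∈ Finset.range n, (lam j * sine j x) • sineL2 j - kappaL2 x‖ ≤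
      ∑' j, 2 * lam (j + n) := by
  have hs : Summable fun j => 2 * lam (j + n) :=
    ((summable_nat_add_iff n).2 summable_lam).mul_left 2
  have h := Lp.norm_le_of_ae_bound
    (f := ∑ j ∈ Finset.range n, (lam j * sine j x) • sineL2 j - kappaL2 x)
    (C := ∑' j, 2 * lam (j + n)) (tsum_nonneg fun j => by have := lam_pos (j + n); positivity) ?_
  · simpa [measureUnivNNReal] using h
  have h2 : ∀ᵐ y ∂volume.restrict (Ioo (0 : ℝ) 1), ∀ j,
      ((lam j * sine j x) • sineL2 j : L2) y = lam j * (sine j x * sine j y) := by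
    rw [ae_all_iff]
    intro j
    filter_upwards [Lp.coeFn_smul (lam j * sine j x) (sineL2 j), sineL2_ae j] with y h3 h4
    rw [h3, Pi.smul_apply, h4, smul_eq_mul, mul_assoc]
  filter_upwards [h2, (memLp_kappa x).coeFn_toLp, ae_restrict_mem measurableSet_Ioo,
    Lp.coeFn_sub (∑ j ∈ Finset.range n, (lam j * sine j x) • sineL2 j) (kappaL2 x),
    Lp.coeFn_finsetSum (Finset.range n) (fun j => (lam j * sine j x) • sineL2 j)]
    with y h2 h3 hy h4 h5
  rw [h4, Pi.sub_apply, h5, kappaL2, h3]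
  rw [Finset.sum_apply, Finset.sum_congr rfl fun j _ => h2 j]
  have hk := hasSum_kappa hx (Ioo_subset_Icc_self hy)
  rw [← hk.tsum_eq, ← hk.summable.sum_add_tsum_nat_add n, sub_add_cancel_left, norm_neg]
  refine tsum_of_norm_bounded hs.hasSum fun j => ?_
  rw [norm_mul, norm_of_nonneg (lam_pos _).le, mul_comm, norm_mul]
  refine mul_le_mul_of_nonneg_right ?_ (lam_pos _).le
  calc _ ≤ √2 * √2 := mul_le_mul (abs_sine_le _ _) (abs_sine_le _ _) (abs_nonneg _) (sqrt_nonneg _)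
    _ = 2 := mul_self_sqrt zero_le_two

/-- Mercer's expansion of the kernel sections in `L²(0,1)`. -/
theorem hasSum_kappaL2 {x : ℝ} (hx : x ∈ Icc (0 : ℝ) 1) :
    HasSum (fun j => (lam j * sine j x) • sineL2 j) (kappaL2 x) := by
  refine (summable_lam_mul_sine_smul x).hasSum_iff_tendsto_nat.2 ?_
  rw [tendsto_iff_norm_sub_tendsto_zero]
  refine squeeze_zero (fun _ => norm_nonneg _) (norm_kappaL2_sub_sum_le hx) ?_
  exact tendsto_sum_nat_add fun j => 2 * lam j

theorem inner_sineL2_of_hasSum {a : ℕ → ℝ} {f : L2} (h : HasSum (fun j => a j • sineL2 j) f)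
    (i : ℕ) : ⟪sineL2 i, f⟫_ℝ = a i := by
  have h1 := h.mapL (innerSL ℝ (sineL2 i))
  refine h1.unique ?_
  convert! hasSum_ite_eq i (a i) using 2 with j
  rw [innerSL_apply_apply, inner_smul_right, orthonormal_iff_ite.1 orthonormal_sineL2]
  by_cases hij : j = i
  · simp [hij]
  · simp [hij, Ne.symm hij]

theorem Kfun_sineL2 (j : ℕ) {x : ℝ} (hx : x ∈ Icc (0 : ℝ) 1) :
    Kfun (sineL2 j) x = lam j * sine j x := by
  rw [Kfun_eq_inner, real_inner_comm, inner_sineL2_of_hasSum (hasSum_kappaL2 hx)]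

theorem hasSum_Kfun (f : L2) {x : ℝ} (hx : x ∈ Icc (0 : ℝ) 1) :
    HasSum (fun j => lam j * sine j x * ⟪sineL2 j, f⟫_ℝ) (Kfun f x) := by
  have h := (hasSum_kappaL2 hx).mapL (innerSL ℝ f)
  rw [Kfun_eq_inner, real_inner_comm]
  convert! h using 2 with j
  rw [innerSL_apply_apply, inner_smul_right, real_inner_comm]

theorem K_sineL2 (j : ℕ) : K (sineL2 j) = lam j • sineL2 j := by
  refine Lp.ext ?_
  filter_upwards [K_ae (sineL2 j), Lp.coeFn_smul (lam j) (sineL2 j), sineL2_ae j,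
    ae_restrict_mem measurableSet_Ioo] with x h1 h2 h3 hx
  rw [h1, h2, Pi.smul_apply, h3, Kfun_sineL2 j (Ioo_subset_Icc_self hx), smul_eq_mul]

/-- A substitute for completeness of the sines: whatever they miss lies in the kernel of `K`. -/
theorem K_eq_zero_of_orthogonal {g : L2} (hg : ∀ j, ⟪sineL2 j, g⟫_ℝ = 0) : K g = 0 := by
  refine Lp.ext ?_
  filter_upwards [K_ae g, Lp.coeFn_zero ℝ 2 (volume.restrict (Ioo (0 : ℝ) 1)),
    ae_restrict_mem measurableSet_Ioo] with x h1 h2 hx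
  rw [h1, h2]
  refine (hasSum_Kfun g (Ioo_subset_Icc_self hx)).unique ?_
  simp [hg, hasSum_zero]

theorem integrable_L2 (f : L2) : Integrable f (volume.restrict (Ioo (0 : ℝ) 1)) :=
  (Lp.memLp f).integrable one_le_two

theorem inner_K_left (f g : L2) : ⟪K f, g⟫_ℝ = ⟪f, K g⟫_ℝ := by
  set μ := volume.restrict (Ioo (0 : ℝ) 1) with hμ
  have h1 : ∀ f g : L2, ⟪K f, g⟫_ℝ = ∫ x, ∫ y, kappa x y * f y * g x ∂μ ∂μ := fun f g => by
    rw [L2.inner_def]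
    refine integral_congr_ae ?_
    filter_upwards [K_ae f] with x hx
    simp [hx, Kfun, ← integral_const_mul, mul_comm]
    rfl
  rw [h1, real_inner_comm, h1, integral_integral_swap]
  · refine integral_congr_ae (Eventually.of_forall fun y => integral_congr_ae
      (Eventually.of_forall fun x => ?_))
    simp only [kappa_eq, min_comm x y]
    ring
  · have h2 := (integrable_L2 g).mul_prod (integrable_L2 f)
    refine (h2.bdd_mul (c := 1) continuous_kappa.aestronglyMeasurable ?_).congr ?_
    · rw [Measure.prod_restrict]
      filter_upwards [ae_restrict_mem (measurableSet_Ioo.prod measurableSet_Ioo)] with p hp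
      exact abs_kappa_le (Ioo_subset_Icc_self hp.1) (Ioo_subset_Icc_self hp.2)
    · refine Eventually.of_forall fun p => ?_
      simp only [Function.uncurry]
      ring

theorem adjoint_K : ContinuousLinearMap.adjoint K = K :=
  ((ContinuousLinearMap.eq_adjoint_iff K K).2 inner_K_left).symm

theorem hasSum_sq_of_hasSum {a : ℕ → ℝ} {f : L2} (h : HasSum (fun j => a j • sineL2 j) f) :
    HasSum (fun j => a j ^ 2) (‖f‖ ^ 2) := by
  have h1 := h.mapL (innerSL ℝ f)
  rw [innerSL_apply_apply, real_inner_self_eq_norm_sq] at h1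
  convert! h1 using 2 with j
  rw [innerSL_apply_apply, inner_smul_right, real_inner_comm, inner_sineL2_of_hasSum h, sq]

theorem summable_smul_sineL2 {a : ℕ → ℝ} (h : Summable fun j => a j ^ 2) :
    Summable fun j => a j • sineL2 j := by
  have h1 := (orthonormal_sineL2.orthogonalFamily.summable_iff_norm_sq_summable (fun j => a j)).2
    (by simpa using h)
  simpa using h1

/-! ### Spectral functions of K*K and the source set in sine coordinates -/

theorem inner_starProjection_eigenspace {T : L2 →L[ℝ] L2} (hT : ∀ x y, ⟪T x, y⟫_ℝ = ⟪x, T y⟫_ℝ)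
    {g : L2} {ν : ℝ} (hg : T g = ν • g) (μ : ℝ) (h : L2) :
    ⟪g, (Module.End.eigenspace (T : Module.End ℝ L2) μ).starProjection h⟫_ℝ =
      if μ = ν then ⟪g, h⟫_ℝ else 0 := by
  split_ifs with hμ
  · subst hμ
    rw [← Submodule.inner_starProjection_left_eq_right,
      Submodule.starProjection_eq_self_iff.2 (Module.End.mem_eigenspace_iff.2 hg)]
  · set w := (Module.End.eigenspace (T : Module.End ℝ L2) μ).starProjection h with hw
    have hw' : T w = μ • w :=
      Module.End.mem_eigenspace_iff.1 (Submodule.starProjection_apply_mem _ h)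
    have h1 := hT g w
    rw [hg, hw', inner_smul_left, inner_smul_right] at h1
    have h2 : (μ - ν) * ⟪g, w⟫_ℝ = 0 := by
      simp only [conj_trivial] at h1; linarith
    exact (mul_eq_zero.1 h2).resolve_left (sub_ne_zero.2 hμ)

theorem exists_eigenvalues_eq {T : L2 →L[ℝ] L2} {g : L2} {ν : ℝ} (hg : T g = ν • g)
    (hg0 : g ≠ 0) : ∃ μ₀ : Module.End.Eigenvalues (T : Module.End ℝ L2),
      ∀ μ : Module.End.Eigenvalues (T : Module.End ℝ L2), μ = μ₀ ↔ (μ : ℝ) = ν :=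
  ⟨⟨ν, Module.End.hasEigenvalue_of_hasEigenvector ⟨Module.End.mem_eigenspace_iff.2 hg, hg0⟩⟩,
    fun _ => Subtype.ext_iff⟩

/-- Eigenspaces of a symmetric operator are mutually orthogonal, so pairing the spectral sum with an
eigenvector leaves a single term. -/
theorem IsSpectralFunction.inner_eq {T : L2 →L[ℝ] L2} (hT : ∀ x y, ⟪T x, y⟫_ℝ = ⟪x, T y⟫_ℝ)
    {φ : ℝ → ℝ} {h f : L2} (hf : IsSpectralFunction T φ h f) {g : L2} {ν : ℝ}
    (hg : T g = ν • g) : ⟪g, f⟫_ℝ = φ ν * ⟪g, h⟫_ℝ := by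
  by_cases hg0 : g = 0
  · simp [hg0]
  have h1 := hf.mapL (innerSL ℝ g)
  rw [innerSL_apply_apply] at h1
  obtain ⟨μ₀, hμ₀⟩ := exists_eigenvalues_eq hg hg0
  refine h1.unique ?_
  classical
  refine (hasSum_ite_eq μ₀ (φ ν * ⟪g, h⟫_ℝ)).congr_fun fun μ => ?_
  rw [innerSL_apply_apply, inner_smul_right, inner_starProjection_eigenspace hT hg]
  by_cases h2 : (μ : ℝ) = ν
  · rw [if_pos h2, if_pos ((hμ₀ μ).2 h2), h2]
  · rw [if_neg h2, if_neg ((hμ₀ μ).not.2 h2), mul_zero]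

theorem isSpectralFunction_eigenvector {T : L2 →L[ℝ] L2}
    (hT : ∀ x y, ⟪T x, y⟫_ℝ = ⟪x, T y⟫_ℝ) (φ : ℝ → ℝ) {g : L2} {ν : ℝ} (hg : T g = ν • g)
    (hg0 : g ≠ 0) : IsSpectralFunction T φ g (φ ν • g) := by
  obtain ⟨μ₀, hμ₀⟩ := exists_eigenvalues_eq hg hg0
  classical
  refine (hasSum_ite_eq μ₀ (φ ν • g)).congr_fun fun μ => ?_
  by_cases h2 : (μ : ℝ) = ν
  · rw [if_pos ((hμ₀ μ).2 h2),
      Submodule.starProjection_eq_self_iff.2 (Module.End.mem_eigenspace_iff.2 (h2.symm ▸ hg)), h2]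
  · rw [if_neg ((hμ₀ μ).not.2 h2)]
    set w := (Module.End.eigenspace (T : Module.End ℝ L2) μ).starProjection g with hw
    have h3 : ⟪w, w⟫_ℝ = 0 := by
      have h4 := inner_starProjection_eigenspace hT hg (μ : ℝ) w
      rw [if_neg h2, ← Submodule.inner_starProjection_left_eq_right, ← hw] at h4
      exact h4
    rw [inner_self_eq_zero.1 h3, smul_zero]

theorem inner_adjoint_K_comp_K (x y : L2) :
    ⟪(ContinuousLinearMap.adjoint K ∘L K) x, y⟫_ℝ =
      ⟪x, (ContinuousLinearMap.adjoint K ∘L K) y⟫_ℝ := by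
  simp only [adjoint_K, ContinuousLinearMap.comp_apply, inner_K_left]

theorem adjoint_K_comp_K_sineL2 (j : ℕ) :
    (ContinuousLinearMap.adjoint K ∘L K) (sineL2 j) = lam j ^ 2 • sineL2 j := by
  simp only [adjoint_K, ContinuousLinearMap.comp_apply, K_sineL2, map_smul, smul_smul, sq]

theorem lam_sq_rpow (s : ℝ) (j : ℕ) : (lam j ^ 2) ^ (s / 2) = lam j ^ s := by
  rw [← rpow_natCast_mul (lam_pos j).le]
  congr 1
  push_cast
  ring

/-- The elements of the source set have the expansion `∑ λ_j^s c_j e_j` with `∑ c_j² ≤ ρ²`. -/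
theorem exists_hasSum_of_mem_sourceSet {s ρ : ℝ} (hs : 0 < s) {f : L2} (hf : f ∈ sourceSet s ρ) :
    ∃ c : ℕ → ℝ, (Summable fun j => c j ^ 2) ∧ ∑' j, c j ^ 2 ≤ ρ ^ 2 ∧
      HasSum (fun j => (lam j ^ s * c j) • sineL2 j) f := by
  obtain ⟨h, hh, hf⟩ := hf
  have hin : ∀ {g : L2} {ν : ℝ}, (ContinuousLinearMap.adjoint K ∘L K) g = ν • g →
      ⟪g, f⟫_ℝ = ν ^ (s / 2) * ⟪g, h⟫_ℝ := fun hg =>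
    IsSpectralFunction.inner_eq inner_adjoint_K_comp_K hf hg
  have hj : ∀ j, ⟪sineL2 j, f⟫_ℝ = lam j ^ s * ⟪sineL2 j, h⟫_ℝ := fun j => by
    rw [hin (adjoint_K_comp_K_sineL2 j), lam_sq_rpow]
  have hsum : Summable fun j => ⟪sineL2 j, h⟫_ℝ ^ 2 := by
    simpa using orthonormal_sineL2.inner_products_summable h
  have hsumf : Summable fun j => ⟪sineL2 j, f⟫_ℝ ^ 2 := by
    simpa using orthonormal_sineL2.inner_products_summable f
  refine ⟨fun j => ⟪sineL2 j, h⟫_ℝ, hsum, ?_, ?_⟩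
  · have h1 : ∑' j, ⟪sineL2 j, h⟫_ℝ ^ 2 ≤ ‖h‖ ^ 2 := by
      simpa using orthonormal_sineL2.tsum_inner_products_le h
    exact h1.trans (pow_le_pow_left₀ (norm_nonneg h) hh 2)
  · simp only [← hj]
    -- `f'` is the sine part of `f`. The rest `f - f'` lies in the kernel of K*K, and t ↦ t^(s/2)
    -- vanishes at 0 because s > 0; so `f - f'` is orthogonal to `f` as well as to `f'`.
    obtain ⟨f', hf'⟩ := summable_smul_sineL2 hsumf
    have h2 : ∀ j, ⟪sineL2 j, f - f'⟫_ℝ = 0 := fun j => by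
      rw [inner_sub_right, inner_sineL2_of_hasSum hf', sub_self]
    have h3 : ⟪f - f', f⟫_ℝ = 0 := by
      rw [hin (g := f - f') (ν := 0), zero_rpow (by positivity), zero_mul]
      rw [ContinuousLinearMap.comp_apply, K_eq_zero_of_orthogonal h2, map_zero, zero_smul]
    have h4 : ⟪f - f', f'⟫_ℝ = 0 := by
      refine (hf'.mapL (innerSL ℝ (f - f'))).unique ?_
      refine hasSum_zero.congr_fun fun j => ?_
      rw [innerSL_apply_apply, inner_smul_right, real_inner_comm _ (f - f'), h2, mul_zero]
    have h5 : f - f' = 0 := by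
      rw [← inner_self_eq_zero (𝕜 := ℝ), inner_sub_right, h3, h4, sub_zero]
    exact (sub_eq_zero.1 h5).symm ▸ hf'

/-- With `j = k` these are the witnesses for the lower bounds on the worst-case tail. -/
theorem smul_sineL2_mem_sourceSet (s : ℝ) {ρ : ℝ} (hρ : 0 < ρ) (j : ℕ) :
    (ρ * lam j ^ s) • sineL2 j ∈ sourceSet s ρ := by
  refine ⟨ρ • sineL2 j, ?_, ?_⟩
  · rw [norm_smul, orthonormal_sineL2.1 j, mul_one, norm_of_nonneg hρ.le]
  · have h := isSpectralFunction_eigenvector inner_adjoint_K_comp_K (fun t => t ^ (s / 2))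
      (g := ρ • sineL2 j) (ν := lam j ^ 2)
      (by rw [map_smul, adjoint_K_comp_K_sineL2, smul_comm])
      (smul_ne_zero hρ.ne' (orthonormal_sineL2.ne_zero j))
    convert! h using 1
    simp only [lam_sq_rpow, smul_smul, mul_comm]

theorem lam_rpow (s : ℝ) (j : ℕ) : lam j ^ s = π ^ (-(2 * s)) * ((j : ℝ) + 1) ^ (-(2 * s)) := by
  have h : lam j = (sineFreq j) ^ (-2 : ℝ) := by
    rw [rpow_neg (sineFreq_pos j).le, lam]
    norm_num
  rw [h, ← rpow_mul (sineFreq_pos j).le, sineFreq, mul_rpow (by positivity) pi_pos.le, mul_comm]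
  ring_nf

theorem lam_rpow_sq (s : ℝ) (j : ℕ) :
    (lam j ^ s) ^ 2 = π ^ (-(4 * s)) * ((j : ℝ) + 1) ^ (-(4 * s)) := by
  rw [lam_rpow, mul_pow, ← rpow_mul_natCast pi_pos.le, ← rpow_mul_natCast (by positivity)]
  push_cast
  ring_nf

/-! ### Discrete orthogonality and aliasing of sines on the grid -/

theorem two_mul_sin_half_mul_sum_cos (θ : ℝ) (N : ℕ) :
    2 * sin (θ / 2) * ∑ l ∈ Finset.range N, cos (l * θ) = sin (N * θ - θ / 2) + sin (θ / 2) := by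
  induction N with
  | zero => simp
  | succ N ih =>
    rw [Finset.sum_range_succ, mul_add, ih]
    push_cast
    rw [show ((N : ℝ) + 1) * θ - θ / 2 = N * θ + θ / 2 by ring, sin_sub, sin_add]
    ring

/-- The range of `k` keeps sin(kπ/(2N)) away from 0, so the Dirichlet kernel identity can be divided
by it. The value depends only on the parity of `k`. -/
theorem sum_cos_int_mul_pi_div {N : ℕ} {k : ℤ} (hk0 : k ≠ 0) (hk1 : -(2 * N) < k)
    (hk2 : k < 2 * N) :
    ∑ l ∈ Finset.range N, cos (l * (k * π / N)) = (1 - (-1) ^ k) / 2 := by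
  have hN : (0 : ℤ) < N := by omega
  have hN' : (0 : ℝ) < N := by exact_mod_cast hN
  set θ := k * π / N with hθ
  have hs : sin (θ / 2) ≠ 0 := by
    intro h
    obtain ⟨q, hq⟩ := sin_eq_zero_iff.1 h
    have h1 : (q : ℝ) * (2 * N) * π = k * π := by
      have : θ * N = k * π := by rw [hθ]; field_simp
      linear_combination 2 * N * hq + this
    have h2 : q * (2 * N) = k := by exact_mod_cast mul_right_cancel₀ pi_ne_zero h1
    have h3 : q < 1 := by
      by_contra h; have : 1 ≤ q := by omega
      nlinarith
    have h4 : -1 < q := by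
      by_contra h; have : q ≤ -1 := by omega
      nlinarith
    have h5 : q = 0 := by omega
    exact hk0 (by rw [← h2, h5, zero_mul])
  have h := two_mul_sin_half_mul_sum_cos θ N
  rw [show (N : ℝ) * θ = k * π by rw [hθ]; field_simp, sin_sub, sin_int_mul_pi,
    cos_int_mul_pi] at h
  have h' : sin (θ / 2) * (2 * ∑ l ∈ Finset.range N, cos (l * θ)) =
    sin (θ / 2) * (1 - (-1) ^ k) := by linarith
  have := mul_left_cancel₀ hs h'
  linarith

/-- The product splits into cosines of wave numbers i-j and i+j+2. These have equal parity, so for i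
≠ j the two sums cancel. -/
theorem sum_sine_grid_mul_sine_grid {n i j : ℕ} (hi : i < n) (hj : j < n) :
    ∑ l : Fin n, sine i (grid n l) * sine j (grid n l) = if i = j then (n : ℝ) + 1 else 0 := by
  have hN : (0 : ℝ) < ((n + 1 : ℕ) : ℝ) := by positivity
  have h1 : ∀ x, sine i (x / ((n : ℝ) + 1)) * sine j (x / ((n : ℝ) + 1)) =
      cos (x * (((i - j : ℤ) : ℝ) * π / (n + 1 : ℕ))) -
        cos (x * (((i + j + 2 : ℤ) : ℝ) * π / (n + 1 : ℕ))) := fun x => by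
    have h3 : (√2) ^ 2 = 2 := sq_sqrt zero_le_two
    have h4 : x * (((i - j : ℤ) : ℝ) * π / (n + 1 : ℕ)) =
        sineFreq i * (x / ((n : ℝ) + 1)) - sineFreq j * (x / ((n : ℝ) + 1)) := by
      unfold sineFreq; push_cast; ring
    have h5 : x * (((i + j + 2 : ℤ) : ℝ) * π / (n + 1 : ℕ)) =
        sineFreq i * (x / ((n : ℝ) + 1)) + sineFreq j * (x / ((n : ℝ) + 1)) := by
      unfold sineFreq; push_cast; ring
    rw [h4, h5, cos_sub, cos_add]
    unfold sine
    linear_combination sin (sineFreq i * (x / ((n : ℝ) + 1))) *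
      sin (sineFreq j * (x / ((n : ℝ) + 1))) * h3
  have h2 : ∑ l : Fin n, sine i (grid n l) * sine j (grid n l) =
      -- The node 0 can be added because the sines vanish there; the sum then runs over N = n+1
      -- equispaced points.
      ∑ l ∈ Finset.range (n + 1), sine i (l / ((n : ℝ) + 1)) * sine j (l / ((n : ℝ) + 1)) := by
    rw [Finset.sum_range_succ', Finset.sum_range fun l => sine i ((l + 1 : ℕ) / ((n : ℝ) + 1)) *
      sine j ((l + 1 : ℕ) / ((n : ℝ) + 1))]
    simp [grid, sine]
  rw [h2]
  simp only [h1]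
  rw [Finset.sum_sub_distrib, sum_cos_int_mul_pi_div (k := i + j + 2) (by omega)
    (by push_cast; omega) (by push_cast; omega)]
  split_ifs with h
  · have : Even ((i : ℤ) + j + 2) := by rw [h]; exact ⟨j + 1, by ring⟩
    rw [this.neg_one_zpow]
    simp [h]
  · rw [sum_cos_int_mul_pi_div (k := i - j) (by omega) (by push_cast; omega) (by push_cast; omega),
      show (i : ℤ) + j + 2 = (i - j) + 2 * (j + 1) by ring, zpow_add₀ (by norm_num) _ (2 * _),
      (even_two_mul ((j : ℤ) + 1)).neg_one_zpow]
    ring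

theorem sine_grid_periodic (n t r : ℕ) (l : Fin n) :
    sine (2 * (n + 1) * t + r) (grid n l) = sine r (grid n l) := by
  unfold sine sineFreq grid
  congr 1
  rw [show (((2 * (n + 1) * t + r : ℕ) : ℝ) + 1) * π * (((l : ℕ) + 1) / ((n : ℝ) + 1)) =
    ((r : ℝ) + 1) * π * (((l : ℕ) + 1) / ((n : ℝ) + 1)) + ((t * (l + 1) : ℕ) : ℝ) * (2 * π) by
      push_cast; field_simp; ring]
  exact sin_add_nat_mul_two_pi _ _

/-- Index `r` has wave number r+1, so the reflection r+1 ↦ 2(n+1) - (r+1) reads r ↦ 2n - r on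
indices. -/
theorem sine_grid_reflect {n r : ℕ} (hr : r ≤ 2 * n) (l : Fin n) :
    sine (2 * n - r) (grid n l) = -sine r (grid n l) := by
  unfold sine sineFreq grid
  rw [← mul_neg, show (((2 * n - r : ℕ) : ℝ) + 1) * π * (((l : ℕ) + 1) / ((n : ℝ) + 1)) =
    (((l : ℕ) + 1 : ℕ) : ℝ) * (2 * π) - ((r : ℝ) + 1) * π * (((l : ℕ) + 1) / ((n : ℝ) + 1)) by
      push_cast [Nat.cast_sub hr]; field_simp; ring]
  rw [sin_nat_mul_two_pi_sub]

theorem sine_grid_self (n : ℕ) (l : Fin n) : sine n (grid n l) = 0 := by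
  have h := sine_grid_reflect (n := n) (r := n) (by omega) l
  rw [show 2 * n - n = n by omega] at h
  linarith

theorem sine_grid_last (n : ℕ) (l : Fin n) : sine (2 * n + 1) (grid n l) = 0 := by
  unfold sine sineFreq grid
  rw [show (((2 * n + 1 : ℕ) : ℝ) + 1) * π * (((l : ℕ) + 1) / ((n : ℝ) + 1)) =
    ((2 * (l + 1) : ℕ) : ℝ) * π by push_cast; field_simp; ring, sin_nat_mul_pi, mul_zero]

/-- The left singular vectors of `K_n`. -/
noncomputable def gridVec (n j : ℕ) : EuclideanSpace ℝ (Fin n) :=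
  WithLp.toLp 2 fun l => sine j (grid n l) / √((n : ℝ) + 1)

theorem gridVec_apply (n j : ℕ) (l : Fin n) :
    gridVec n j l = sine j (grid n l) / √((n : ℝ) + 1) := rfl

theorem inner_gridVec {n i j : ℕ} (hi : i < n) (hj : j < n) :
    ⟪gridVec n i, gridVec n j⟫_ℝ = if i = j then 1 else 0 := by
  have hN : (0 : ℝ) < (n : ℝ) + 1 := by positivity
  have h : ⟪gridVec n i, gridVec n j⟫_ℝ =
      (∑ l : Fin n, sine i (grid n l) * sine j (grid n l)) / ((n : ℝ) + 1) := by
    rw [PiLp.inner_apply, Finset.sum_div]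
    refine Finset.sum_congr rfl fun l _ => ?_
    rw [gridVec_apply, gridVec_apply]
    simp only [RCLike.inner_apply, conj_trivial]
    rw [div_mul_div_comm, mul_self_sqrt hN.le, mul_comm]
  rw [h, sum_sine_grid_mul_sine_grid hi hj]
  split_ifs
  · exact div_self hN.ne'
  · exact zero_div _

theorem Km_sineL2 (n i : ℕ) : Km n (sineL2 i) = (lam i * √((n : ℝ) + 1)) • gridVec n i := by
  have hN : (0 : ℝ) < √((n : ℝ) + 1) := sqrt_pos.2 (by positivity)
  ext l
  rw [Km_apply, Kfun_sineL2 i (grid_mem l), PiLp.smul_apply, gridVec_apply, smul_eq_mul]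
  field_simp

theorem gridVec_periodic (n t r : ℕ) : gridVec n (2 * (n + 1) * t + r) = gridVec n r := by
  ext l; rw [gridVec_apply, gridVec_apply, sine_grid_periodic]

theorem gridVec_reflect {n r : ℕ} (hr : r ≤ 2 * n) : gridVec n (2 * n - r) = -gridVec n r := by
  ext l; rw [gridVec_apply, PiLp.neg_apply, gridVec_apply, sine_grid_reflect hr, neg_div]

theorem gridVec_self (n : ℕ) : gridVec n n = 0 := by
  ext l; rw [gridVec_apply, sine_grid_self, zero_div]; rfl

theorem gridVec_last (n : ℕ) : gridVec n (2 * n + 1) = 0 := by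
  ext l; rw [gridVec_apply, sine_grid_last, zero_div]; rfl

/-! ### Spectrum of K_n K_n^* and uniqueness of the singular value decomposition -/

/-- The image of the `j`-th left singular vector under `K_n^*`. -/
noncomputable def adjVec (n j : ℕ) : L2 := ContinuousLinearMap.adjoint (Km n) (gridVec n j)

theorem inner_adjVec (n j : ℕ) (f : L2) : ⟪adjVec n j, f⟫_ℝ = ⟪gridVec n j, Km n f⟫_ℝ :=
  ContinuousLinearMap.adjoint_inner_left (Km n) f (gridVec n j)

theorem inner_adjVec_sineL2 (n i j : ℕ) :
    ⟪adjVec n j, sineL2 i⟫_ℝ = lam i * √((n : ℝ) + 1) * ⟪gridVec n j, gridVec n i⟫_ℝ := by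
  rw [inner_adjVec, Km_sineL2, inner_smul_right]

/-- The contribution of the `t`-th pair of aliases of the `j`-th frequency. -/
noncomputable def aliasTerm (n j t : ℕ) : ℝ :=
  lam (2 * (n + 1) * t + j) ^ 2 + lam (2 * (n + 1) * t + (2 * n - j)) ^ 2

/-- The eigenvalues of `K_n K_n^*`, divided by `n + 1`. -/
noncomputable def gridEig (n j : ℕ) : ℝ := ∑' t, aliasTerm n j t

theorem lam_sq (j : ℕ) : lam j ^ 2 = 1 / π ^ 4 * (1 / ((j : ℝ) + 1) ^ 4) := by
  unfold lam sineFreq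
  field_simp

theorem summable_lam_sq : Summable fun j => lam j ^ 2 := by
  have h := (summable_nat_add_iff 1).2 hasSum_zeta_four.summable
  refine (h.mul_left (1 / π ^ 4)).congr fun j => ?_
  rw [lam_sq]
  push_cast
  rfl

theorem summable_lam_sq_comp (n r : ℕ) : Summable fun t => lam (2 * (n + 1) * t + r) ^ 2 := by
  refine summable_lam_sq.comp_injective fun a b h => ?_
  have h1 : 2 * (n + 1) * a = 2 * (n + 1) * b := by simpa using h
  exact Nat.eq_of_mul_eq_mul_left (by omega) h1

theorem summable_aliasTerm (n j : ℕ) : Summable (aliasTerm n j) :=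
  (summable_lam_sq_comp n j).add (summable_lam_sq_comp n (2 * n - j))

/-- Used with N = 2(n+1) to sort the sine series of Kf into alias classes. -/
theorem hasSum_residues {F : ℕ → ℝ} {a : ℝ} (hF : HasSum F a) (N : ℕ) [NeZero N] :
    HasSum (fun t => ∑ r ∈ Finset.range N, F (N * t + r)) a := by
  have h := (Nat.divModEquiv N).symm.hasSum_iff.2 hF
  have h2 := h.prod_fiberwise fun t => hasSum_fintype _
  refine h2.congr_fun fun t => ?_
  rw [Finset.sum_range]
  refine Finset.sum_congr rfl fun r _ => ?_
  simp [Nat.divModEquiv, mul_comm]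

/-- Every other residue gives, up to sign, a different member of the orthonormal family, or the zero
vector when r = n or r = 2n+1. -/
theorem inner_gridVec_of_ne {n j r : ℕ} (hj : j < n) (hr : r < 2 * (n + 1)) (h1 : r ≠ j)
    (h2 : r ≠ 2 * n - j) : ⟪gridVec n j, gridVec n r⟫_ℝ = 0 := by
  rcases lt_trichotomy r n with h | h | h
  · rw [inner_gridVec hj h, if_neg (Ne.symm h1)]
  · rw [h, gridVec_self, inner_zero_right]
  · rcases eq_or_ne r (2 * n + 1) with h3 | h3
    · rw [h3, gridVec_last, inner_zero_right]
    · rw [show r = 2 * n - (2 * n - r) by omega, gridVec_reflect (by omega), inner_neg_right,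
        inner_gridVec hj (by omega), if_neg (by omega), neg_zero]

theorem Km_adjVec {n j : ℕ} (hj : j < n) :
    Km n (adjVec n j) = (((n : ℝ) + 1) * gridEig n j) • gridVec n j := by
  have hN : (0 : ℝ) < (n : ℝ) + 1 := by positivity
  ext l
  have h1 := hasSum_residues (hasSum_Kfun (adjVec n j) (grid_mem l)) (2 * (n + 1))
  have h2 := (summable_aliasTerm n j).hasSum.mul_right (√((n : ℝ) + 1) * sine j (grid n l))
  rw [Km_apply, PiLp.smul_apply, gridVec_apply, smul_eq_mul]
  refine (h1.unique (h2.congr_fun fun t => ?_)).trans ?_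
  -- Only the residues j and 2n-j survive. For the latter a reflection sign appears in the inner
  -- product and again in the sampled sine, so the two cancel.
  · rw [Finset.sum_eq_add_of_mem j (2 * n - j) (by simp; omega) (by simp; omega) (by omega)]
    · rw [real_inner_comm, inner_adjVec_sineL2, gridVec_periodic,
        real_inner_comm (adjVec n j) (sineL2 (2 * (n + 1) * t + (2 * n - j))),
        inner_adjVec_sineL2, gridVec_periodic,
        gridVec_reflect (by omega), inner_neg_right, inner_gridVec hj hj, if_pos rfl,
        sine_grid_periodic, sine_grid_periodic, sine_grid_reflect (by omega), aliasTerm]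
      ring
    · intro r hr hne
      rw [real_inner_comm, inner_adjVec_sineL2, gridVec_periodic,
        inner_gridVec_of_ne hj (Finset.mem_range.1 hr) hne.1 hne.2]
      ring
  · rw [← gridEig]
    have : (n : ℝ) + 1 = √((n : ℝ) + 1) ^ 2 := (sq_sqrt hN.le).symm
    field_simp
    rw [← this]

theorem lam_sq_le_gridEig (n j : ℕ) : lam j ^ 2 ≤ gridEig n j := by
  have h := (summable_aliasTerm n j).le_tsum 0 fun t _ => by unfold aliasTerm; positivity
  refine le_trans ?_ h
  unfold aliasTerm
  simp only [mul_zero, zero_add, le_add_iff_nonneg_right]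
  positivity

theorem gridEig_pos (n j : ℕ) : 0 < gridEig n j :=
  lt_of_lt_of_le (by have := lam_pos j; positivity) (lam_sq_le_gridEig n j)

theorem gridEig_le {n j : ℕ} (hj : j < n) :
    gridEig n j ≤ lam j ^ 2 + 2 / (π ^ 4 * ((n : ℝ) + 1) ^ 4) := by
  have hN : (0 : ℝ) < (n : ℝ) + 1 := by positivity
  have hA := summable_lam_sq_comp n j
  have hB := summable_lam_sq_comp n (2 * n - j)
  have hA' := (summable_nat_add_iff 1).2 hA
  have h1 : gridEig n j = lam j ^ 2 + ∑' t, (lam (2 * (n + 1) * (t + 1) + j) ^ 2 +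
      lam (2 * (n + 1) * t + (2 * n - j)) ^ 2) := by
    unfold gridEig aliasTerm
    rw [hA.tsum_add hB, hA'.tsum_add hB, hA.tsum_eq_zero_add]
    simp [add_assoc]
  rw [h1]
  gcongr
  -- In the t-th group the two wave numbers are at least 2(n+1)(t+1) and (n+1)(t+1), which gives
  -- 1/16 + 1 = 17/16 times the terms of ζ(4) = π⁴/90. The crude bound 32/17 below makes the total
  -- 2.
  have hz : HasSum
      (fun t : ℕ => 17 / (16 * π ^ 4 * ((n : ℝ) + 1) ^ 4) * (1 / (((t + 1 : ℕ) : ℝ) ^ 4)))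
      (17 / (16 * π ^ 4 * ((n : ℝ) + 1) ^ 4) * (π ^ 4 / 90)) := by
    have := (hasSum_nat_add_iff' 1).2 hasSum_zeta_four
    simp only [Finset.sum_range_one] at this
    norm_num at this ⊢
    exact this.mul_left _
  have hpi : π ^ 4 / 90 ≤ 32 / 17 := by
    have h3 : π ^ 4 ≤ 3.15 ^ 4 := pow_le_pow_left₀ pi_pos.le pi_lt_d2.le 4
    norm_num at h3
    linarith
  refine ((hA'.add hB).tsum_le_tsum (fun t => ?_) hz.summable).trans ?_
  · have hj' : (j : ℝ) + 1 ≤ n := by exact_mod_cast hj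
    rw [lam_sq, lam_sq]
    push_cast [Nat.cast_sub (show j ≤ 2 * n by omega)]
    have ha : 2 * ((n : ℝ) + 1) * (t + 1) ≤ 2 * ((n : ℝ) + 1) * (t + 1) + j + 1 := by
      have : (0 : ℝ) ≤ j := Nat.cast_nonneg j
      linarith
    have hb : ((n : ℝ) + 1) * (t + 1) ≤ 2 * ((n : ℝ) + 1) * t + (2 * n - j) + 1 := by
      have : (0 : ℝ) ≤ (n + 1) * t := by positivity
      nlinarith
    calc _ ≤ 1 / π ^ 4 * (1 / (2 * ((n : ℝ) + 1) * (t + 1)) ^ 4) +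
        1 / π ^ 4 * (1 / (((n : ℝ) + 1) * (t + 1)) ^ 4) := by gcongr
      _ = _ := by field_simp; norm_num
  · rw [hz.tsum_eq]
    calc _ ≤ 17 / (16 * π ^ 4 * ((n : ℝ) + 1) ^ 4) * (32 / 17) := by gcongr
      _ = _ := by field_simp; norm_num

/-- Strict convexity of x⁻⁴: at fixed sum, moving two points together lowers the sum of values. The
two increments are factored and share the factor x' - x. -/
theorem one_div_pow_four_add_lt {x x' y y' : ℝ} (hx : 0 < x) (hxx : x < x') (hxy : x' ≤ y')
    (h : x + y = x' + y') : 1 / x' ^ 4 + 1 / y' ^ 4 < 1 / x ^ 4 + 1 / y ^ 4 := by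
  have hx' : 0 < x' := hx.trans hxx
  have hy' : 0 < y' := hx'.trans_le hxy
  have hyy : y' < y := by linarith
  have hy : 0 < y := hy'.trans hyy
  have e1 : 1 / x ^ 4 - 1 / x' ^ 4 = (x' - x) *
      (1 / (x * x' ^ 4) + 1 / (x ^ 2 * x' ^ 3) + 1 / (x ^ 3 * x' ^ 2) + 1 / (x ^ 4 * x')) := by
    field_simp; ring
  have e2 : 1 / y' ^ 4 - 1 / y ^ 4 = (y - y') *
      (1 / (y' * y ^ 4) + 1 / (y' ^ 2 * y ^ 3) + 1 / (y' ^ 3 * y ^ 2) + 1 / (y' ^ 4 * y)) := by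
    field_simp; ring
  have e3 : y - y' = x' - x := by linarith
  have h1 : x < y' := hxx.trans_le hxy
  have h2 : x' < y := hxy.trans_lt hyy
  have e4 : 1 / (y' * y ^ 4) + 1 / (y' ^ 2 * y ^ 3) + 1 / (y' ^ 3 * y ^ 2) + 1 / (y' ^ 4 * y) <
      1 / (x * x' ^ 4) + 1 / (x ^ 2 * x' ^ 3) + 1 / (x ^ 3 * x' ^ 2) + 1 / (x ^ 4 * x') := by
    gcongr
  have := mul_lt_mul_of_pos_left e4 (sub_pos.2 hxx)
  rw [e3] at e2
  linarith

/-- The sum of the two wave numbers in a pair does not depend on the index, and their gap shrinks as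
the index grows towards n. -/
theorem aliasTerm_lt {n i j : ℕ} (hij : i < j) (hj : j < n) (t : ℕ) :
    aliasTerm n j t < aliasTerm n i t := by
  have hi' : (i : ℝ) + 1 ≤ j := by exact_mod_cast hij
  have hj' : (j : ℝ) + 1 ≤ n := by exact_mod_cast hj
  have h : (0 : ℝ) ≤ (i : ℝ) := by positivity
  have h' : (0 : ℝ) ≤ 2 * ((n : ℝ) + 1) * t := by positivity
  simp only [aliasTerm, lam_sq, ← mul_add]
  refine mul_lt_mul_of_pos_left ?_ (by positivity)
  push_cast [Nat.cast_sub (show j ≤ 2 * n by omega), Nat.cast_sub (show i ≤ 2 * n by omega)]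
  exact one_div_pow_four_add_lt (by linarith) (by linarith) (by linarith) (by ring)

theorem gridEig_lt {n i j : ℕ} (hij : i < j) (hj : j < n) : gridEig n j < gridEig n i :=
  Summable.tsum_lt_tsum (i := 0) (fun t => (aliasTerm_lt hij hj t).le) (aliasTerm_lt hij hj 0)
    (summable_aliasTerm n j) (summable_aliasTerm n i)

theorem inner_adjVec_adjVec {n i j : ℕ} (hi : i < n) (hj : j < n) :
    ⟪adjVec n i, adjVec n j⟫_ℝ = if i = j then ((n : ℝ) + 1) * gridEig n j else 0 := by
  rw [inner_adjVec, Km_adjVec hj, inner_smul_right, inner_gridVec hi hj]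
  split_ifs <;> simp

theorem orthonormal_gridVec (n : ℕ) : Orthonormal ℝ fun j : Fin n => gridVec n j := by
  rw [orthonormal_iff_ite]
  intro i j
  rw [inner_gridVec i.2 j.2]
  simp [Fin.ext_iff]

theorem sum_inner_gridVec_smul {n : ℕ} (y : EuclideanSpace ℝ (Fin n)) :
    ∑ j : Fin n, ⟪gridVec n j, y⟫_ℝ • gridVec n j = y := by
  have h := (orthonormal_gridVec n).linearIndependent.span_eq_top_of_card_eq_finrank' (by simp)
  have h2 := (OrthonormalBasis.mk (orthonormal_gridVec n) h.ge).sum_repr' y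
  simpa using h2

/-- The singular value decomposition of `K_n` is unique up to signs. -/
theorem IsSVD.exists_sign {n : ℕ} {v : Fin n → L2} {u : Fin n → EuclideanSpace ℝ (Fin n)}
    {σ : Fin n → ℝ} (h : IsSVD (Km n) v u σ) (j : Fin n) :
    σ j ^ 2 = ((n : ℝ) + 1) * gridEig n j ∧ ∃ ε : ℝ, ε ^ 2 = 1 ∧ u j = ε • gridVec n j := by
  have hN : (0 : ℝ) < (n : ℝ) + 1 := by positivity
  have hinj : ∀ {i i' : Fin n}, gridEig n i = gridEig n i' → i = i' := fun {i i'} hii => by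
    by_contra hne
    rcases lt_or_gt_of_ne hne with hlt | hlt
    · exact (gridEig_lt hlt i'.2).ne' hii
    · exact (gridEig_lt hlt i.2).ne hii
  have horth : ∀ i j : Fin n,
      (((n : ℝ) + 1) * gridEig n i - σ j ^ 2) * ⟪gridVec n i, u j⟫_ℝ = 0 := by
    intro i j
    have h1 : ⟪Km n (adjVec n i), u j⟫_ℝ = σ j ^ 2 * ⟪gridVec n i, u j⟫_ℝ := by
      rw [← ContinuousLinearMap.adjoint_inner_right, inner_adjVec, h.adjoint_apply_u, map_smul,
        h.apply_v, smul_smul, inner_smul_right, sq]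
    rw [Km_adjVec i.2, inner_smul_left] at h1
    simp only [conj_trivial] at h1
    linarith
  have hex : ∀ j : Fin n, ∃ i : Fin n, ⟪gridVec n i, u j⟫_ℝ ≠ 0 := by
    intro j
    by_contra! hc
    refine h.orthonormal_u.ne_zero j ?_
    rw [← sum_inner_gridVec_smul (u j)]
    exact Finset.sum_eq_zero fun i _ => by rw [hc, zero_smul]
  -- `p j` is an index whose grid vector overlaps `u j`. Simplicity of the eigenvalues makes it the
  -- only one, so `u j` is a multiple of that grid vector.
  choose p hp using hex
  have hσ : ∀ j, σ j ^ 2 = ((n : ℝ) + 1) * gridEig n (p j) := fun j => by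
    have := (mul_eq_zero.1 (horth (p j) j)).resolve_right (hp j)
    linarith
  have hu : ∀ j, u j = ⟪gridVec n (p j), u j⟫_ℝ • gridVec n (p j) := fun j => by
    conv_lhs => rw [← sum_inner_gridVec_smul (u j)]
    refine Finset.sum_eq_single (p j) (fun i _ hi => ?_) (by simp)
    have h1 := (mul_eq_zero.1 (horth i j)).resolve_left fun h2 => hi (hinj ?_)
    · rw [h1, zero_smul]
    · rw [hσ j, ← mul_sub] at h2
      exact sub_eq_zero.1 ((mul_eq_zero.1 h2).resolve_left hN.ne')
  have hpinj : Function.Injective p := fun j j' hjj => by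
    by_contra hne
    have h1 : ⟪u j, u j'⟫_ℝ = 0 := h.orthonormal_u.2 hne
    rw [hu j, hu j', hjj, inner_smul_left, inner_smul_right, inner_gridVec (p j').2 (p j').2,
      if_pos rfl] at h1
    have h2 := hp j
    rw [hjj] at h2
    simp only [conj_trivial, mul_one, mul_eq_zero] at h1
    exact h1.elim h2 (hp j')
  have hpmono : Monotone p := fun j j' hjj => by
    by_contra hlt
    have h1 := gridEig_lt (not_le.1 hlt) (p j).2
    have h2 := pow_le_pow_left₀ (h.pos j').le (h.antitone hjj) 2
    rw [hσ, hσ] at h2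
    exact absurd (le_of_mul_le_mul_left h2 hN) (not_le.2 h1)
  -- Both families are ordered by decreasing singular value, so `p` is monotone; being also
  -- injective on `Fin n`, it is the identity.
  have hpid : p = id := (hpmono.strictMono_of_injective hpinj).eq_id
  refine ⟨by simpa [hpid] using hσ j, ⟪gridVec n j, u j⟫_ℝ, ?_, by simpa [hpid] using hu j⟩
  have h1 := h.orthonormal_u.1 j
  have h2 := hu j
  rw [hpid, id] at h2
  have h3 : ⟪u j, u j⟫_ℝ = 1 := by rw [real_inner_self_eq_norm_sq, h1, one_pow]
  rw [h2, inner_smul_left, inner_smul_right, inner_gridVec j.2 j.2, if_pos rfl] at h3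
  simp only [conj_trivial, mul_one] at h3
  rw [sq, h3]

theorem IsSVD.sq_inner_v {n : ℕ} {v : Fin n → L2} {u : Fin n → EuclideanSpace ℝ (Fin n)}
    {σ : Fin n → ℝ} (h : IsSVD (Km n) v u σ) (j : Fin n) (f : L2) :
    ⟪v j, f⟫_ℝ ^ 2 = ⟪adjVec n j, f⟫_ℝ ^ 2 / (((n : ℝ) + 1) * gridEig n j) := by
  obtain ⟨hσ, ε, hε, hu⟩ := h.exists_sign j
  have h1 : ⟪ContinuousLinearMap.adjoint (Km n) (u j), f⟫_ℝ ^ 2 = σ j ^ 2 * ⟪v j, f⟫_ℝ ^ 2 := by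
    rw [h.adjoint_apply_u, inner_smul_left, mul_pow]; rfl
  rw [hu, map_smul, inner_smul_left, mul_pow] at h1
  simp only [conj_trivial, hε, one_mul] at h1
  rw [← hσ, eq_div_iff (pow_pos (h.pos j) 2).ne', mul_comm, ← h1]
  rfl

/-! ### Approximation error over the source set and bounds on singular values -/

/-- The squared distance of `f` to the span of the first `k` right singular vectors of `K_n`. -/
noncomputable def tailSq (n k : ℕ) (f : L2) : ℝ :=
  ‖f‖ ^ 2 - ∑ j ∈ Finset.range k, ⟪adjVec n j, f⟫_ℝ ^ 2 / (((n : ℝ) + 1) * gridEig n j)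

/-- The sum of the inverse squares of the first `k` singular values of `K_n`. -/
noncomputable def noiseAmp (n k : ℕ) : ℝ :=
  ∑ j ∈ Finset.range k, 1 / (((n : ℝ) + 1) * gridEig n j)

theorem norm_sq_sum_smul {E ι : Type*} [NormedAddCommGroup E] [InnerProductSpace ℝ E]
    [DecidableEq ι] {t : Finset ι} {x : ι → E} {d : ι → ℝ}
    (hx : ∀ i ∈ t, ∀ j ∈ t, ⟪x i, x j⟫_ℝ = if i = j then d j else 0) (b : ι → ℝ) :
    ‖∑ i ∈ t, b i • x i‖ ^ 2 = ∑ i ∈ t, b i ^ 2 * d i := by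
  rw [← real_inner_self_eq_norm_sq, sum_inner]
  refine Finset.sum_congr rfl fun i hi => ?_
  rw [inner_sum, Finset.sum_eq_single i]
  · rw [inner_smul_left, inner_smul_right, hx i hi i hi, if_pos rfl, conj_trivial]; ring
  · intro j hj hji
    rw [inner_smul_left, inner_smul_right, hx i hi j hj, if_neg (Ne.symm hji), mul_zero, mul_zero]
  · exact fun h => absurd hi h

/-- Best approximation by the orthogonal projection, shown by completing a square in each
coefficient. It permits a convenient trial element in place of the projection. -/
theorem tailSq_le_norm_sub_sq {n k : ℕ} (hk : k ≤ n) (f : L2) (b : ℕ → ℝ) :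
    tailSq n k f ≤ ‖f - ∑ j ∈ Finset.range k, b j • adjVec n j‖ ^ 2 := by
  have hlt : ∀ j ∈ Finset.range k, j < n := fun j hj => (Finset.mem_range.1 hj).trans_le hk
  rw [norm_sub_sq_real, norm_sq_sum_smul (d := fun j => ((n : ℝ) + 1) * gridEig n j)
    (fun i hi j hj => inner_adjVec_adjVec (hlt i hi) (hlt j hj)), inner_sum, Finset.mul_sum,
    sub_add, ← Finset.sum_sub_distrib, tailSq]
  refine sub_le_sub_left (Finset.sum_le_sum fun j _ => ?_) _
  rw [inner_smul_right, real_inner_comm f]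
  set q := ((n : ℝ) + 1) * gridEig n j with hq
  have hq0 : 0 < q := mul_pos (by positivity) (gridEig_pos n j)
  rw [le_div_iff₀ hq0]
  nlinarith [sq_nonneg (⟪f, adjVec n j⟫_ℝ - b j * q)]

/-- The normalized alias error of the `j`-th right singular vector of `K_n`. -/
noncomputable def aliasErr (n j : ℕ) : L2 :=
  (1 / (√((n : ℝ) + 1) * lam j)) • adjVec n j - sineL2 j

/-- Distinct frequencies below n have disjoint alias classes, so the alias errors add up in squares.
-/
theorem inner_aliasErr {n i j : ℕ} (hi : i < n) (hj : j < n) :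
    ⟪aliasErr n i, aliasErr n j⟫_ℝ = if i = j then gridEig n j / lam j ^ 2 - 1 else 0 := by
  have hN : (0 : ℝ) < (n : ℝ) + 1 := by positivity
  have hN' : (0 : ℝ) < √((n : ℝ) + 1) := sqrt_pos.2 hN
  have hl := lam_pos j
  unfold aliasErr
  rw [inner_sub_left, inner_sub_right, inner_sub_right, inner_smul_left, inner_smul_right,
    inner_smul_left, inner_smul_right, real_inner_comm (adjVec n j) (sineL2 i),
    inner_adjVec_adjVec hi hj, inner_adjVec_sineL2, inner_adjVec_sineL2, inner_gridVec hi hj,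
    inner_gridVec hj hi, orthonormal_iff_ite.1 orthonormal_sineL2]
  by_cases hij : i = j
  · subst hij
    simp only [if_true, conj_trivial, mul_one]
    have : √((n : ℝ) + 1) ^ 2 = (n : ℝ) + 1 := sq_sqrt hN.le
    field_simp
    rw [this]
    field_simp
    ring
  · simp [hij, Ne.symm hij]

theorem gridEig_div_lam_sq_sub_one_le {n j : ℕ} (hj : j < n) :
    gridEig n j / lam j ^ 2 - 1 ≤ 2 * ((j : ℝ) + 1) ^ 4 / ((n : ℝ) + 1) ^ 4 := by
  have hl := lam_pos j
  have h := gridEig_le hj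
  rw [sub_le_iff_le_add, div_le_iff₀ (by positivity)]
  refine h.trans (le_of_eq ?_)
  rw [lam_sq]
  field_simp
  ring

/-- Handles both signs of the exponent at once; it is applied with 4 - 4s, which changes sign at s =
1. -/
theorem rpow_le_rpow_add_one {x y : ℝ} (hx : 1 ≤ x) (hxy : x ≤ y) (a : ℝ) :
    x ^ a ≤ y ^ a + 1 := by
  rcases le_total 0 a with ha | ha
  · linarith [rpow_le_rpow (by linarith) hxy ha]
  · linarith [rpow_le_one_of_one_le_of_nonpos hx ha, rpow_nonneg (by linarith : 0 ≤ y) a]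

/-- The trial element replaces each of the first k sines by its normalized `adjVec`. The error is
the sine tail plus orthogonal alias errors of relative size 2((j+1)/(n+1))⁴. The term (n+1)⁻⁴ is the
saturation for large s. -/
theorem tailSq_le {s ρ : ℝ} (hs : 0 < s) {n k : ℕ} (hk : k ≤ n) {f : L2}
    (hf : f ∈ sourceSet s ρ) :
    tailSq n k f ≤ 2 * ρ ^ 2 * π ^ (-(4 * s)) *
      (3 * ((k : ℝ) + 1) ^ (-(4 * s)) + 2 / ((n : ℝ) + 1) ^ 4) := by
  obtain ⟨c, hc, hcρ, hfc⟩ := exists_hasSum_of_mem_sourceSet hs hf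
  have hlt : ∀ j ∈ Finset.range k, j < n := fun j hj => (Finset.mem_range.1 hj).trans_le hk
  have hN : (0 : ℝ) < (n : ℝ) + 1 := by positivity
  have hN' : (0 : ℝ) < √((n : ℝ) + 1) := sqrt_pos.2 hN
  set a : ℕ → ℝ := fun j => lam j ^ s * c j with ha
  have hasq : ∀ j, a j ^ 2 = π ^ (-(4 * s)) * ((j : ℝ) + 1) ^ (-(4 * s)) * c j ^ 2 := fun j => by
    rw [ha, mul_pow, lam_rpow_sq]
  set low := ∑ j ∈ Finset.range k, a j • sineL2 j with hlow
  set g := ∑ j ∈ Finset.range k, (a j / (√((n : ℝ) + 1) * lam j)) • adjVec n j with hg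
  have h1 : ‖f - low‖ ^ 2 ≤ π ^ (-(4 * s)) * ((k : ℝ) + 1) ^ (-(4 * s)) * ρ ^ 2 := by
    have h2 : HasSum (fun j => a (j + k) ^ 2) (‖f - low‖ ^ 2) := by
      have h3 := hasSum_sq_of_hasSum hfc
      have h4 : ‖f - low‖ ^ 2 = ‖f‖ ^ 2 - ∑ j ∈ Finset.range k, a j ^ 2 := by
        rw [norm_sub_sq_real, hlow, norm_sq_sum_smul (d := fun _ => 1)
          (fun i _ j _ => orthonormal_iff_ite.1 orthonormal_sineL2 i j), inner_sum]
        have h5 : ∀ j, ⟪f, a j • sineL2 j⟫_ℝ = a j ^ 2 := fun j => by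
          rw [inner_smul_right, real_inner_comm, inner_sineL2_of_hasSum hfc]; ring
        simp only [h5, mul_one]
        ring
      rw [h4]
      exact (hasSum_nat_add_iff' k).2 h3
    have hck : Summable fun j => c (j + k) ^ 2 := (summable_nat_add_iff k).2 hc
    have h6 : ∑' j, c (j + k) ^ 2 ≤ ρ ^ 2 := by
      refine le_trans ?_ hcρ
      rw [← hc.sum_add_tsum_nat_add k]
      exact le_add_of_nonneg_left (Finset.sum_nonneg fun _ _ => sq_nonneg _)
    rw [← h2.tsum_eq]
    refine (h2.summable.tsum_le_tsum (fun j => ?_)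
      (hck.mul_left (π ^ (-(4 * s)) * ((k : ℝ) + 1) ^ (-(4 * s))))).trans ?_
    · rw [hasq]
      gcongr ?_ * ?_ * ?_
      refine rpow_le_rpow_of_nonpos (by positivity) ?_ (by linarith)
      push_cast
      linarith [Nat.cast_nonneg (α := ℝ) j]
    · rw [tsum_mul_left]
      gcongr
  have h2 : ‖low - g‖ ^ 2 ≤ π ^ (-(4 * s)) *
      (2 * (((k : ℝ) + 1) ^ (-(4 * s)) + 1 / ((n : ℝ) + 1) ^ 4)) * ρ ^ 2 := by
    have h3 : low - g = ∑ j ∈ Finset.range k, (-a j) • aliasErr n j := by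
      rw [hlow, hg, ← Finset.sum_sub_distrib]
      refine Finset.sum_congr rfl fun j _ => ?_
      rw [aliasErr, smul_sub, smul_smul, neg_mul, neg_smul, neg_smul, mul_one_div]
      abel
    rw [h3, norm_sq_sum_smul (d := fun j => gridEig n j / lam j ^ 2 - 1)
      fun i hi j hj => inner_aliasErr (hlt i hi) (hlt j hj)]
    have h4 : ∑ j ∈ Finset.range k, c j ^ 2 ≤ ρ ^ 2 :=
      (hc.sum_le_tsum _ fun _ _ => sq_nonneg _).trans hcρ
    refine le_trans ?_ (mul_le_mul_of_nonneg_left h4 (by positivity))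
    rw [Finset.mul_sum]
    refine Finset.sum_le_sum fun j hj => ?_
    have hj1 : (j : ℝ) + 1 ≤ (n : ℝ) + 1 := by
      have : (j : ℝ) ≤ n := by exact_mod_cast (hlt j hj).le
      linarith
    have hj0 : (0 : ℝ) < (j : ℝ) + 1 := by positivity
    -- The source weight (j+1)^(-4s) times the alias factor (j+1)⁴ is a power with exponent 4 - 4s.
    have h5 := rpow_le_rpow_add_one (by linarith [Nat.cast_nonneg (α := ℝ) j]) hj1 (4 - 4 * s)
    have h6 : ∀ x : ℝ, 0 < x → x ^ (4 - 4 * s) = x ^ (-(4 * s)) * x ^ 4 := fun x hx => by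
      rw [← rpow_natCast x 4, ← rpow_add hx]
      push_cast
      ring_nf
    rw [h6 _ hj0, h6 _ hN] at h5
    have h7 : ((n : ℝ) + 1) ^ (-(4 * s)) ≤ ((k : ℝ) + 1) ^ (-(4 * s)) := by
      refine rpow_le_rpow_of_nonpos (by positivity) ?_ (by linarith)
      have : (k : ℝ) ≤ n := by exact_mod_cast hk
      linarith
    calc (-a j) ^ 2 * (gridEig n j / lam j ^ 2 - 1)
        ≤ a j ^ 2 * (2 * ((j : ℝ) + 1) ^ 4 / ((n : ℝ) + 1) ^ 4) := by
          rw [neg_sq]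
          exact mul_le_mul_of_nonneg_left (gridEig_div_lam_sq_sub_one_le (hlt j hj)) (sq_nonneg _)
      _ = π ^ (-(4 * s)) * (2 * ((((j : ℝ) + 1) ^ (-(4 * s)) * ((j : ℝ) + 1) ^ 4) /
            ((n : ℝ) + 1) ^ 4)) * c j ^ 2 := by
          rw [hasq]; ring
      _ ≤ π ^ (-(4 * s)) * (2 * ((((n : ℝ) + 1) ^ (-(4 * s)) * ((n : ℝ) + 1) ^ 4 + 1) /
            ((n : ℝ) + 1) ^ 4)) * c j ^ 2 := by gcongr
      _ = π ^ (-(4 * s)) * (2 * (((n : ℝ) + 1) ^ (-(4 * s)) + 1 / ((n : ℝ) + 1) ^ 4)) *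
            c j ^ 2 := by
          rw [add_div, mul_div_cancel_right₀ _ (by positivity)]
      _ ≤ _ := by gcongr
  have h3 : ‖f - g‖ ^ 2 ≤ 2 * ‖f - low‖ ^ 2 + 2 * ‖low - g‖ ^ 2 := by
    have h4 : ‖f - g‖ ≤ ‖f - low‖ + ‖low - g‖ := norm_sub_le_norm_sub_add_norm_sub _ _ _
    nlinarith [sq_nonneg (‖f - low‖ - ‖low - g‖), norm_nonneg (f - g)]
  refine (tailSq_le_norm_sub_sq hk f fun j => a j / (√((n : ℝ) + 1) * lam j)).trans ?_
  refine h3.trans ((add_le_add (mul_le_mul_of_nonneg_left h1 zero_le_two)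
    (mul_le_mul_of_nonneg_left h2 zero_le_two)).trans (le_of_eq ?_))
  ring

theorem norm_sq_le_of_mem_sourceSet {s ρ : ℝ} (hs : 0 < s) {f : L2} (hf : f ∈ sourceSet s ρ) :
    ‖f‖ ^ 2 ≤ ρ ^ 2 * π ^ (-(4 * s)) := by
  obtain ⟨c, hc, hcρ, hfc⟩ := exists_hasSum_of_mem_sourceSet hs hf
  have h := hasSum_sq_of_hasSum hfc
  rw [← h.tsum_eq]
  refine (h.summable.tsum_le_tsum (fun j => ?_) (hc.mul_left (π ^ (-(4 * s))))).trans ?_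
  · rw [mul_pow, lam_rpow_sq]
    gcongr
    refine mul_le_of_le_one_right (by positivity)
      (rpow_le_one_of_one_le_of_nonpos (by linarith [Nat.cast_nonneg (α := ℝ) j]) (by linarith))
  · rw [tsum_mul_left, mul_comm]
    gcongr

/-- The k-th sine is orthogonal to the first k singular vectors, so nothing is captured. For k = n
this holds because its samples vanish. -/
theorem tailSq_smul_sineL2 (s ρ : ℝ) {n k : ℕ} (hk : k ≤ n) :
    tailSq n k ((ρ * lam k ^ s) • sineL2 k) =
      ρ ^ 2 * π ^ (-(4 * s)) * ((k : ℝ) + 1) ^ (-(4 * s)) := by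
  rw [tailSq, Finset.sum_eq_zero, sub_zero, norm_smul, orthonormal_sineL2.1 k, mul_one,
    norm_eq_abs, sq_abs, mul_pow, lam_rpow_sq, mul_assoc]
  intro j hj
  have hjk := Finset.mem_range.1 hj
  have h : ⟪gridVec n j, gridVec n k⟫_ℝ = 0 := by
    rcases hk.lt_or_eq with h | h
    · rw [inner_gridVec (hjk.trans h) h, if_neg hjk.ne]
    · rw [h, gridVec_self, inner_zero_right]
  rw [inner_smul_right, inner_adjVec_sineL2, h]
  simp

theorem one_div_gridEig_le (n j : ℕ) :
    1 / (((n : ℝ) + 1) * gridEig n j) ≤ π ^ 4 * ((j : ℝ) + 1) ^ 4 / ((n : ℝ) + 1) := by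
  have h := lam_sq_le_gridEig n j
  have := gridEig_pos n j
  rw [lam_sq] at h
  calc _ ≤ 1 / (((n : ℝ) + 1) * (1 / π ^ 4 * (1 / ((j : ℝ) + 1) ^ 4))) := by gcongr
    _ = _ := by field_simp

/-- Since j+1 ≤ n+1, the aliases contribute at most 2λ_j², hence the factor 3. -/
theorem le_one_div_gridEig {n j : ℕ} (hj : j < n) :
    π ^ 4 * ((j : ℝ) + 1) ^ 4 / (3 * ((n : ℝ) + 1)) ≤ 1 / (((n : ℝ) + 1) * gridEig n j) := by
  have h := gridEig_le hj
  have := gridEig_pos n j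
  have hj1 : (j : ℝ) + 1 ≤ (n : ℝ) + 1 := by
    have : (j : ℝ) ≤ n := by exact_mod_cast hj.le
    linarith
  have h1 : gridEig n j ≤ 3 / (π ^ 4 * ((j : ℝ) + 1) ^ 4) := by
    rw [lam_sq] at h
    calc _ ≤ 1 / π ^ 4 * (1 / ((j : ℝ) + 1) ^ 4) + 2 / (π ^ 4 * ((j : ℝ) + 1) ^ 4) :=
          h.trans (by gcongr)
      _ = _ := by field_simp; norm_num
  calc _ = 1 / (((n : ℝ) + 1) * (3 / (π ^ 4 * ((j : ℝ) + 1) ^ 4))) := by field_simp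
    _ ≤ _ := by gcongr

/-! ### Mean squared error of the cut-off: tail, bias and noise -/

theorem spectralCutoff_add {n : ℕ} (v : Fin n → L2) (u : Fin n → EuclideanSpace ℝ (Fin n))
    (σ : Fin n → ℝ) (k : ℕ) (y w : EuclideanSpace ℝ (Fin n)) :
    spectralCutoff v u σ k (y + w) = spectralCutoff v u σ k y + spectralCutoff v u σ k w := by
  simp only [spectralCutoff, inner_add_left, add_div, add_smul, Finset.sum_add_distrib]

theorem integral_sum_mul_sum {Ω ι κ : Type*} [MeasurableSpace Ω] {P : Measure Ω}
    {X : ι → Ω → ℝ} {Y : κ → Ω → ℝ} (hX : ∀ i, MemLp (X i) 2 P) (hY : ∀ i, MemLp (Y i) 2 P)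
    (s : Finset ι) (t : Finset κ) :
    ∫ ω, (∑ i ∈ s, X i ω) * ∑ j ∈ t, Y j ω ∂P = ∑ i ∈ s, ∑ j ∈ t, ∫ ω, X i ω * Y j ω ∂P := by
  have h : ∀ i j, Integrable (fun ω => X i ω * Y j ω) P := fun i j => (hX i).integrable_mul (hY j)
  simp only [Finset.sum_mul_sum]
  rw [integral_finsetSum _ fun i _ => integrable_finsetSum _ fun j _ => h i j]
  exact Finset.sum_congr rfl fun i _ => integral_finsetSum _ fun j _ => h i j

/-- The mean squared error of the spectral cut-off for centered noise with covariance `τ I`. -/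
theorem lintegral_spectralCutoff_sub {Ω : Type*} [MeasurableSpace Ω] {P : Measure Ω}
    [IsProbabilityMeasure P] {n : ℕ} {v : Fin n → L2} {u : Fin n → EuclideanSpace ℝ (Fin n)}
    (hv : Orthonormal ℝ v) (hu : Orthonormal ℝ u) (σ : Fin n → ℝ) (k : ℕ) {W : Fin n → Ω → ℝ}
    {τ : ℝ} (hW : ∀ l, MemLp (W l) 2 P) (hmean : ∀ l, ∫ ω, W l ω ∂P = 0)
    (hcov : ∀ l l', ∫ ω, W l ω * W l' ω ∂P = if l = l' then τ else 0)
    (y : EuclideanSpace ℝ (Fin n)) (f : L2) :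
    ∫⁻ ω, ‖spectralCutoff v u σ k (y + WithLp.toLp 2 fun l => W l ω) - f‖ₑ ^ 2 ∂P =
      ENNReal.ofReal (‖spectralCutoff v u σ k y - f‖ ^ 2 +
        τ * ∑ j ∈ Finset.univ.filter (fun j : Fin n => (j : ℕ) < k), 1 / σ j ^ 2) := by
  set J := Finset.univ.filter (fun j : Fin n => (j : ℕ) < k) with hJ
  set a := spectralCutoff v u σ k y - f with ha
  set X : Fin n → Ω → ℝ := fun j ω => ∑ l, u j l * W l ω with hX
  have hXW : ∀ j, ∀ l, MemLp (fun ω => u j l * W l ω) 2 P := fun j l => (hW l).const_mul (u j l)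
  have hX2 : ∀ j, MemLp (X j) 2 P := fun j => memLp_finsetSum _ fun l _ => hXW j l
  have hXmean : ∀ j, ∫ ω, X j ω ∂P = 0 := fun j => by
    rw [hX, integral_finsetSum _ fun l _ => (hXW j l).integrable one_le_two]
    simp [integral_const_mul, hmean]
  have hXvar : ∀ j, ∫ ω, X j ω ^ 2 ∂P = τ := fun j => by
    have h1 : ∑ l, u j l * u j l = 1 := by
      have := orthonormal_iff_ite.1 hu j j
      rw [if_pos rfl, PiLp.inner_apply] at this
      simpa [← sq] using this
    simp only [hX, sq]
    rw [integral_sum_mul_sum (hXW j) (hXW j)]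
    have h2 : ∀ l l', ∫ ω, u j l * W l ω * (u j l' * W l' ω) ∂P =
        if l = l' then u j l * u j l * τ else 0 := fun l l' => by
      have h3 : ∀ ω, u j l * W l ω * (u j l' * W l' ω) = u j l * u j l' * (W l ω * W l' ω) :=
        fun ω => by ring
      simp only [h3]
      rw [integral_const_mul, hcov]
      split_ifs with h
      · rw [h]
      · rw [mul_zero]
    simp only [h2, Finset.sum_ite_eq, Finset.mem_univ, if_true]
    rw [← Finset.sum_mul, h1, one_mul]
  have hexp : ∀ ω, ‖spectralCutoff v u σ k (y + WithLp.toLp 2 fun l => W l ω) - f‖ ^ 2 =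
      ‖a‖ ^ 2 + ∑ j ∈ J, (2 * (⟪a, v j⟫_ℝ / σ j) * X j ω + 1 / σ j ^ 2 * X j ω ^ 2) := fun ω => by
    have h1 : ∀ j, ⟪(WithLp.toLp 2 fun l => W l ω : EuclideanSpace ℝ (Fin n)), u j⟫_ℝ = X j ω :=
      fun j => by
        rw [PiLp.inner_apply]
        simp [hX]
    rw [spectralCutoff_add, add_sub_right_comm, ← ha, norm_add_sq_real, spectralCutoff, ← hJ,
      norm_sq_sum_smul (d := fun _ => 1) (fun i _ j _ => orthonormal_iff_ite.1 hv i j), inner_sum,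
      Finset.mul_sum, add_assoc, ← Finset.sum_add_distrib]
    congr 1
    refine Finset.sum_congr rfl fun j _ => ?_
    rw [h1, inner_smul_right]
    ring
  have hint : ∀ j, Integrable
      (fun ω => 2 * (⟪a, v j⟫_ℝ / σ j) * X j ω + 1 / σ j ^ 2 * X j ω ^ 2) P :=
    fun j => (((hX2 j).integrable one_le_two).const_mul _).add ((hX2 j).integrable_sq.const_mul _)
  have hint2 : Integrable (fun ω => ‖a‖ ^ 2 +
      ∑ j ∈ J, (2 * (⟪a, v j⟫_ℝ / σ j) * X j ω + 1 / σ j ^ 2 * X j ω ^ 2)) P :=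
    (integrable_const (μ := P) (‖a‖ ^ 2)).add
    (integrable_finsetSum J fun j _ => hint j)
  have h0 : ∀ ω, ‖spectralCutoff v u σ k (y + WithLp.toLp 2 fun l => W l ω) - f‖ₑ ^ 2 =
      ENNReal.ofReal (‖a‖ ^ 2 +
        ∑ j ∈ J, (2 * (⟪a, v j⟫_ℝ / σ j) * X j ω + 1 / σ j ^ 2 * X j ω ^ 2)) := fun ω => by
    rw [← hexp, ← ofReal_norm, ENNReal.ofReal_pow (norm_nonneg _)]
  simp only [h0]
  rw [← ofReal_integral_eq_lintegral_ofReal hint2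
    (Eventually.of_forall fun ω => by
      simp only [Pi.zero_apply]; rw [← hexp]; positivity)]
  congr 1
  rw [integral_add (integrable_const _) (integrable_finsetSum J fun j _ => hint j),
    integral_finsetSum _ fun j _ => hint j, integral_const, probReal_univ, one_smul, Finset.mul_sum]
  congr 1
  refine Finset.sum_congr rfl fun j _ => ?_
  rw [integral_add (((hX2 j).integrable one_le_two).const_mul _)
    ((hX2 j).integrable_sq.const_mul _), integral_const_mul, integral_const_mul, hXmean, hXvar]
  ring

theorem sum_filter_lt_eq_sum_range {n k : ℕ} (hk : k ≤ n) (F : ℕ → ℝ) :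
    ∑ j ∈ Finset.univ.filter (fun j : Fin n => (j : ℕ) < k), F j = ∑ j ∈ Finset.range k, F j := by
  rw [Finset.sum_filter, ← Finset.sum_range fun j => if j < k then F j else 0,
    ← Finset.sum_filter]
  congr 1
  ext j
  simp only [Finset.mem_filter, Finset.mem_range]
  omega

section SVD

variable {n : ℕ} {v : Fin n → L2} {u : Fin n → EuclideanSpace ℝ (Fin n)} {σ : Fin n → ℝ}

/-- The squared size of the first `k` coefficients of the reconstruction from a data error `b`. -/
noncomputable def biasSq (u : Fin n → EuclideanSpace ℝ (Fin n)) (σ : Fin n → ℝ) (k : ℕ)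
    (b : EuclideanSpace ℝ (Fin n)) : ℝ :=
  ∑ j ∈ Finset.univ.filter (fun j : Fin n => (j : ℕ) < k), (⟪b, u j⟫_ℝ / σ j) ^ 2

theorem biasSq_nonneg (u : Fin n → EuclideanSpace ℝ (Fin n)) (σ : Fin n → ℝ) (k : ℕ)
    (b : EuclideanSpace ℝ (Fin n)) : 0 ≤ biasSq u σ k b :=
  Finset.sum_nonneg fun _ _ => sq_nonneg _

/-- Bessel's inequality, with 1/σ_j² at most π⁴k⁴/(n+1) for all indices below k. -/
theorem IsSVD.biasSq_le (h : IsSVD (Km n) v u σ) (k : ℕ) (b : EuclideanSpace ℝ (Fin n)) :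
    biasSq u σ k b ≤ π ^ 4 * (k : ℝ) ^ 4 / ((n : ℝ) + 1) * ‖b‖ ^ 2 := by
  have h1 : ∑ j ∈ Finset.univ.filter (fun j : Fin n => (j : ℕ) < k), ⟪u j, b⟫_ℝ ^ 2 ≤ ‖b‖ ^ 2 := by
    simpa using h.orthonormal_u.sum_inner_products_le b
      (s := Finset.univ.filter (fun j : Fin n => (j : ℕ) < k))
  refine le_trans ?_ (mul_le_mul_of_nonneg_left h1 (by positivity))
  rw [biasSq, Finset.mul_sum]
  refine Finset.sum_le_sum fun j hj => ?_
  have hjk : ((j : ℕ) : ℝ) + 1 ≤ k := by exact_mod_cast (Finset.mem_filter.1 hj).2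
  rw [div_pow, (h.exists_sign j).1, real_inner_comm, div_eq_mul_one_div, mul_comm]
  refine mul_le_mul_of_nonneg_right ((one_div_gridEig_le n j).trans ?_) (sq_nonneg _)
  gcongr

/-- Exact data reproduce the projection of `f`, so the data error only adds a component inside the
span, orthogonal to the tail. -/
theorem IsSVD.norm_spectralCutoff_sub_sq (h : IsSVD (Km n) v u σ) {k : ℕ} (hk : k ≤ n) (f : L2)
    (b : EuclideanSpace ℝ (Fin n)) :
    ‖spectralCutoff v u σ k (Km n f + b) - f‖ ^ 2 = tailSq n k f + biasSq u σ k b := by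
  have h1 : ∀ j, ⟪Km n f + b, u j⟫_ℝ / σ j = ⟪v j, f⟫_ℝ + ⟪b, u j⟫_ℝ / σ j := fun j => by
    rw [inner_add_left, add_div, ← ContinuousLinearMap.adjoint_inner_right, h.adjoint_apply_u,
      inner_smul_right, mul_div_cancel_left₀ _ (h.pos j).ne', real_inner_comm]
  rw [norm_sub_sq_real, spectralCutoff, norm_sq_sum_smul (d := fun _ => 1)
    (fun i _ j _ => orthonormal_iff_ite.1 h.orthonormal_v i j), sum_inner, tailSq, biasSq,
    ← sum_filter_lt_eq_sum_range hk, Finset.mul_sum, ← Finset.sum_sub_distrib]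
  have h2 : ∀ A B C D : ℝ, A = C - B → A + D = D - B + C := by intros; linarith
  refine h2 _ _ _ _ ?_
  rw [← Finset.sum_sub_distrib]
  refine Finset.sum_congr rfl fun j _ => ?_
  rw [h1, inner_smul_left, ← h.sq_inner_v, conj_trivial]
  ring

theorem IsSVD.sum_one_div_sq (h : IsSVD (Km n) v u σ) {k : ℕ} (hk : k ≤ n) :
    ∑ j ∈ Finset.univ.filter (fun j : Fin n => (j : ℕ) < k), 1 / σ j ^ 2 = noiseAmp n k := by
  rw [noiseAmp, ← sum_filter_lt_eq_sum_range hk]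
  exact Finset.sum_congr rfl fun j _ => by rw [(h.exists_sign j).1]

theorem IsSVD.lintegral_error (h : IsSVD (Km n) v u σ) {Ω : Type*} [MeasurableSpace Ω]
    {P : Measure Ω} [IsProbabilityMeasure P] {k : ℕ} (hk : k ≤ n) {W : Fin n → Ω → ℝ}
    {τ : ℝ} (hW : ∀ l, MemLp (W l) 2 P) (hmean : ∀ l, ∫ ω, W l ω ∂P = 0)
    (hcov : ∀ l l', ∫ ω, W l ω * W l' ω ∂P = if l = l' then τ else 0)
    (b : EuclideanSpace ℝ (Fin n)) (f : L2) :
    ∫⁻ ω, ‖spectralCutoff v u σ k (Km n f + b + WithLp.toLp 2 fun l => W l ω) - f‖ₑ ^ 2 ∂P =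
      ENNReal.ofReal (tailSq n k f + biasSq u σ k b + τ * noiseAmp n k) := by
  rw [lintegral_spectralCutoff_sub h.orthonormal_v h.orthonormal_u σ k hW hmean hcov,
    h.norm_spectralCutoff_sub_sq hk, h.sum_one_div_sq hk]

end SVD

/-! ### Systematic error of averaged data -/

theorem abs_kappa_sub_le (x x' : ℝ) {y : ℝ} (hy : y ∈ Icc (0 : ℝ) 1) :
    |kappa x y - kappa x' y| ≤ |x - x'| := by
  wlog hxx : x ≤ x' generalizing x x'
  · rw [abs_sub_comm, abs_sub_comm x]
    exact this x' x (le_of_not_ge hxx)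
  obtain ⟨hy0, hy1⟩ := hy
  have h1 : min x y ≤ min x' y := min_le_min_right y hxx
  have h2 : min x' y ≤ min x y + (x' - x) := by
    rcases le_total x y with h | h
    · rw [min_eq_left h]; linarith [min_le_left x' y]
    · rw [min_eq_right h]; linarith [min_le_right x' y]
  rw [kappa_eq, kappa_eq, abs_of_nonpos (sub_nonpos.2 hxx), abs_le]
  constructor <;> nlinarith

theorem norm_kappaL2_sub_le (x x' : ℝ) : ‖kappaL2 x - kappaL2 x'‖ ≤ |x - x'| := by
  have h := Lp.norm_le_of_ae_bound (f := kappaL2 x - kappaL2 x') (abs_nonneg (x - x')) (by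
    filter_upwards [(memLp_kappa x).coeFn_toLp, (memLp_kappa x').coeFn_toLp,
      Lp.coeFn_sub (kappaL2 x) (kappaL2 x'), ae_restrict_mem measurableSet_Ioo] with y h1 h2 h3 hy
    rw [h3, Pi.sub_apply, kappaL2, kappaL2, h1, h2]
    exact abs_kappa_sub_le x x' (Ioo_subset_Icc_self hy))
  simpa [measureUnivNNReal] using h

theorem abs_Kfun_sub_le (f : L2) (x x' : ℝ) : |Kfun f x - Kfun f x'| ≤ |x - x'| * ‖f‖ := by
  rw [Kfun_eq_inner, Kfun_eq_inner, ← inner_sub_left]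
  exact (abs_real_inner_le_norm _ _).trans
    (mul_le_mul_of_nonneg_right (norm_kappaL2_sub_le x x') (norm_nonneg f))

/-- After clearing denominators the numerator is (o-1)(i-M) + j(M+1), which lies between
±(o-1)(M+1). -/
theorem abs_block_sub_le {M o i j : ℕ} (hi : i < M) (hj : j < o) :
    |(((i * o + j : ℕ) : ℝ) + 1) / (((M * o : ℕ) : ℝ) + 1) - ((i : ℝ) + 1) / ((M : ℝ) + 1)| ≤
      ((o : ℝ) - 1) / (((M * o : ℕ) : ℝ) + 1) := by
  have hi' : (i : ℝ) + 1 ≤ M := by exact_mod_cast hi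
  have hj' : (j : ℝ) + 1 ≤ o := by exact_mod_cast hj
  have hi0 : (0 : ℝ) ≤ i := Nat.cast_nonneg i
  have hj0 : (0 : ℝ) ≤ j := Nat.cast_nonneg j
  have hM : (0 : ℝ) < (M : ℝ) + 1 := by positivity
  have hm : (0 : ℝ) < ((M * o : ℕ) : ℝ) + 1 := by positivity
  rw [div_sub_div _ _ hm.ne' hM.ne', abs_div, abs_of_pos (mul_pos hm hM),
    div_le_div_iff₀ (mul_pos hm hM) hm]
  rw [mul_comm (((M * o : ℕ) : ℝ) + 1) ((M : ℝ) + 1), ← mul_assoc]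
  refine mul_le_mul_of_nonneg_right ?_ hm.le
  push_cast
  have h1 : 0 ≤ ((o : ℝ) - 1) * (M - i - 1) := mul_nonneg (by linarith) (by linarith)
  have h2 : 0 ≤ ((o : ℝ) - 1 - j) * (M + 1) := mul_nonneg (by linarith) hM.le
  have h3 : 0 ≤ (j : ℝ) * (M + 1) := by positivity
  have h4 : 0 ≤ ((o : ℝ) - 1) * i := mul_nonneg (by linarith) hi0
  rw [abs_le]
  constructor <;> nlinarith

/-- The index of the `j`-th entry of the `i`-th block of length `o`. -/
def blockIdx {m o : ℕ} (i : Fin (m / o)) (j : Fin o) : Fin m :=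
  ⟨(i : ℕ) * o + j, calc
    (i : ℕ) * o + j < (i : ℕ) * o + o := Nat.add_lt_add_left j.2 _
    _ = ((i : ℕ) + 1) * o := by ring
    _ ≤ m / o * o := Nat.mul_le_mul_right _ i.2
    _ ≤ m := Nat.div_mul_le_self m o⟩

theorem blockIdx_inj {m o : ℕ} {i i' : Fin (m / o)} {j j' : Fin o} :
    blockIdx i j = blockIdx i' j' ↔ i = i' ∧ j = j' := by
  refine ⟨fun h => ?_, fun h => by rw [h.1, h.2]⟩
  have h1 : (i : ℕ) * o + j = i' * o + j' := congrArg Fin.val h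
  have ho : 0 < o := (Nat.zero_le _).trans_lt j.2
  have h2 : (i : ℕ) = i' := by
    have := congrArg (· / o) h1
    simpa [Nat.mul_add_div, mul_comm _ o, ho, Nat.div_eq_of_lt] using this
  exact ⟨Fin.ext h2, Fin.ext (by rw [h2] at h1; omega)⟩

/-- The systematic error of the averaged data. -/
noncomputable def avgBias (m o : ℕ) (f : L2) : EuclideanSpace ℝ (Fin (m / o)) :=
  WithLp.toLp 2 fun i => (∑ j : Fin o, Kfun f (grid m (blockIdx i j))) / o -
    Kfun f (grid (m / o) i)

theorem noisyData_eq (m : ℕ) (δ : ℝ) (f : L2) (z : Fin m → ℝ) :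
    noisyData m δ f z = Km m f + 0 + WithLp.toLp 2 fun l => δ * z l := by
  ext l
  simp [noisyData, Km_apply]

theorem blockAverage_noisyData_eq (m o : ℕ) (δ : ℝ) (f : L2) (z : Fin m → ℝ) :
    blockAverage o (noisyData m δ f z) =
      Km (m / o) f + avgBias m o f + WithLp.toLp 2 fun i => ∑ j, δ / o * z (blockIdx i j) := by
  ext i
  simp only [PiLp.add_apply, Km_apply, avgBias, ← Finset.mul_sum]
  change (∑ j : Fin o, (Kfun f (grid m (blockIdx i j)) + δ * z (blockIdx i j))) / o = _
  rw [Finset.sum_add_distrib, ← Finset.mul_sum]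
  ring

/-- Each entry is a mean of increments of Kf over distances at most (o-1)/(m+1). In particular the
bound vanishes for o = 1. -/
theorem norm_avgBias_sq_le {m o : ℕ} (ho : 0 < o) (hom : o ∣ m) (f : L2) :
    ‖avgBias m o f‖ ^ 2 ≤ ((m / o : ℕ) : ℝ) * (((o : ℝ) - 1) / ((m : ℝ) + 1) * ‖f‖) ^ 2 := by
  have ho' : (0 : ℝ) < o := by exact_mod_cast ho
  have hmo : m / o * o = m := Nat.div_mul_cancel hom
  rw [EuclideanSpace.norm_sq_eq]
  refine (Finset.sum_le_card_nsmul _ _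
    ((((o : ℝ) - 1) / ((m : ℝ) + 1) * ‖f‖) ^ 2) fun i _ => ?_).trans
    (le_of_eq (by rw [Finset.card_univ, Fintype.card_fin, nsmul_eq_mul]))
  rw [norm_eq_abs]
  refine pow_le_pow_left₀ (abs_nonneg _) ?_ 2
  have h1 : avgBias m o f i =
      (∑ j : Fin o, (Kfun f (grid m (blockIdx i j)) - Kfun f (grid (m / o) i))) / o := by
    rw [Finset.sum_sub_distrib, sub_div]
    simp [avgBias, ho'.ne']
  rw [h1, abs_div, abs_of_pos ho', div_le_iff₀ ho']
  refine (Finset.abs_sum_le_sum_abs _ _).trans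
    ((Finset.sum_le_card_nsmul _ _ _ fun j _ => ?_).trans
      (le_of_eq (by rw [Finset.card_univ, Fintype.card_fin, nsmul_eq_mul, mul_comm])))
  refine (abs_Kfun_sub_le f _ _).trans (mul_le_mul_of_nonneg_right ?_ (norm_nonneg f))
  have h2 := abs_block_sub_le i.2 j.2
  rw [hmo] at h2
  exact h2

theorem IsSVD.biasSq_avgBias_le {m o : ℕ} (ho : 0 < o) (hom : o ∣ m) {v : Fin (m / o) → L2}
    {u : Fin (m / o) → EuclideanSpace ℝ (Fin (m / o))} {σ : Fin (m / o) → ℝ}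
    (h : IsSVD (Km (m / o)) v u σ) (k : ℕ) (f : L2) :
    biasSq u σ k (avgBias m o f) ≤
      π ^ 4 * (k : ℝ) ^ 4 * (((o : ℝ) - 1) / ((m : ℝ) + 1)) ^ 2 * ‖f‖ ^ 2 := by
  refine (h.biasSq_le k _).trans ?_
  have h1 : ((m / o : ℕ) : ℝ) / (((m / o : ℕ) : ℝ) + 1) ≤ 1 := by
    rw [div_le_one (by positivity)]; linarith
  calc _ ≤ π ^ 4 * (k : ℝ) ^ 4 / (((m / o : ℕ) : ℝ) + 1) *
        (((m / o : ℕ) : ℝ) * (((o : ℝ) - 1) / ((m : ℝ) + 1) * ‖f‖) ^ 2) :=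
        mul_le_mul_of_nonneg_left (norm_avgBias_sq_le ho hom f) (by positivity)
    _ = ((m / o : ℕ) : ℝ) / (((m / o : ℕ) : ℝ) + 1) *
        (π ^ 4 * (k : ℝ) ^ 4 * (((o : ℝ) - 1) / ((m : ℝ) + 1)) ^ 2 * ‖f‖ ^ 2) := by ring
    _ ≤ _ := mul_le_of_le_one_left (by positivity) h1

/-! ### Covariance of the averaged noise -/

section Noise

variable {Ω : Type*} [MeasurableSpace Ω] {P : Measure Ω} {m : ℕ} {Z : Fin m → Ω → ℝ}

theorem memLp_of_integral_sq_eq_one (hZ_ident : ∀ i j, IdentDistrib (Z i) (Z j) P P)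
    (hZ_var : ∀ i, ∫ ω, Z i ω ^ 2 ∂P = 1) (l : Fin m) : MemLp (Z l) 2 P := by
  rw [memLp_two_iff_integrable_sq (hZ_ident l l).aemeasurable_fst.aestronglyMeasurable]
  -- The Bochner integral of a non-integrable function is 0, so second moment 1 forces
  -- integrability.
  exact Integrable.of_integral_ne_zero (by rw [hZ_var]; exact one_ne_zero)

theorem integral_mul_eq_ite (hZ_indep : iIndepFun Z P)
    (hZ_ident : ∀ i j, IdentDistrib (Z i) (Z j) P P) (hZ_mean : ∀ i, ∫ ω, Z i ω ∂P = 0)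
    (hZ_var : ∀ i, ∫ ω, Z i ω ^ 2 ∂P = 1) (l l' : Fin m) :
    ∫ ω, Z l ω * Z l' ω ∂P = if l = l' then 1 else 0 := by
  have hm := fun l => (hZ_ident l l).aemeasurable_fst.aestronglyMeasurable
  split_ifs with h
  · subst h
    rw [← hZ_var l]
    simp only [sq]
  · rw [(hZ_indep.indepFun h).integral_fun_mul_eq_mul_integral (hm l) (hm l'), hZ_mean, zero_mul]

theorem integral_blockSum_mul {o : ℕ} (hZ2 : ∀ l, MemLp (Z l) 2 P)
    (hZ : ∀ l l', ∫ ω, Z l ω * Z l' ω ∂P = if l = l' then 1 else 0) (δ : ℝ)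
    (i i' : Fin (m / o)) :
    ∫ ω, (∑ j : Fin o, δ / o * Z (blockIdx i j) ω) * ∑ j : Fin o, δ / o * Z (blockIdx i' j) ω ∂P =
      if i = i' then δ ^ 2 / o else 0 := by
  rw [integral_sum_mul_sum (fun j => (hZ2 (blockIdx i j)).const_mul (δ / o))
    (fun j => (hZ2 (blockIdx i' j)).const_mul (δ / o))]
  have h1 : ∀ j j' : Fin o, ∫ ω, δ / o * Z (blockIdx i j) ω * (δ / o * Z (blockIdx i' j') ω) ∂P =
      (δ / o) ^ 2 * if i = i' ∧ j = j' then 1 else 0 := fun j j' => by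
    have h2 : ∀ ω, δ / o * Z (blockIdx i j) ω * (δ / o * Z (blockIdx i' j') ω) =
        (δ / o) ^ 2 * (Z (blockIdx i j) ω * Z (blockIdx i' j') ω) := fun ω => by ring
    simp only [h2]
    rw [integral_const_mul, hZ]
    simp only [blockIdx_inj]
  simp only [h1]
  split_ifs with h
  · rcases eq_or_ne (o : ℝ) 0 with h0 | h0
    · simp [h0]
    · simp [h]
      field_simp
  · simp [h]

end Noise

/-- The mean squared error of the spectral cut-off built from `n` point evaluations. -/
noncomputable def mse (n k : ℕ) (τ : ℝ) (f : L2) : ℝ := tailSq n k f + τ * noiseAmp n k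

theorem mse_zero (n : ℕ) (τ : ℝ) (f : L2) : mse n 0 τ f = ‖f‖ ^ 2 := by
  simp [mse, tailSq, noiseAmp]

theorem biasSq_zero {n : ℕ} (u : Fin n → EuclideanSpace ℝ (Fin n)) (σ : Fin n → ℝ) (k : ℕ) :
    biasSq u σ k 0 = 0 := by
  simp [biasSq]

/-- It is the squared error of the cut-off applied to exact data, for any decomposition. -/
theorem tailSq_nonneg {n k : ℕ} (hk : k ≤ n) (f : L2) : 0 ≤ tailSq n k f := by
  obtain ⟨v, u, σ, h⟩ := exists_isSVD_Km n
  have h1 := h.norm_spectralCutoff_sub_sq hk f 0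
  rw [biasSq_zero] at h1
  linarith [sq_nonneg ‖spectralCutoff v u σ k (Km n f + 0) - f‖]

theorem noiseAmp_nonneg (n k : ℕ) : 0 ≤ noiseAmp n k :=
  Finset.sum_nonneg fun j _ => by have := gridEig_pos n j; positivity

theorem le_noiseAmp {n k : ℕ} (hk0 : 1 ≤ k) (hk : k ≤ n) :
    π ^ 4 * (k : ℝ) ^ 4 / (3 * ((n : ℝ) + 1)) ≤ noiseAmp n k := by
  obtain ⟨j, rfl⟩ : ∃ j, k = j + 1 := ⟨k - 1, by omega⟩
  have h := le_one_div_gridEig (n := n) (j := j) (by omega)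
  push_cast
  refine h.trans ?_
  exact Finset.single_le_sum (f := fun j => 1 / (((n : ℝ) + 1) * gridEig n j))
    (fun j _ => by have := gridEig_pos n j; positivity) (Finset.self_mem_range_succ j)

/-! ### Comparing the risks for full and averaged data -/

section Comparison

variable {m M o : ℕ} {δ s ρ : ℝ}

/-- Termwise, since o(M+1) = m+o ≥ m+1; the 3 is the gap between the two bounds on 1/σ_j². -/
theorem div_noiseAmp_le (ho : 1 ≤ o) (hmo : M * o = m) {k : ℕ} (hk : k ≤ M) :
    1 / (o : ℝ) * noiseAmp M k ≤ 3 * noiseAmp m k := by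
  have ho' : (1 : ℝ) ≤ o := by exact_mod_cast ho
  have hmo' : (M : ℝ) * o = m := by exact_mod_cast hmo
  have hMm : M ≤ m := by nlinarith
  rw [noiseAmp, noiseAmp, Finset.mul_sum, Finset.mul_sum]
  refine Finset.sum_le_sum fun j hj => ?_
  have hjk := Finset.mem_range.1 hj
  have h1 := one_div_gridEig_le M j
  have h2 := le_one_div_gridEig (n := m) (j := j) (by omega)
  calc _ ≤ 1 / (o : ℝ) * (π ^ 4 * ((j : ℝ) + 1) ^ 4 / ((M : ℝ) + 1)) := by gcongr
    _ = π ^ 4 * ((j : ℝ) + 1) ^ 4 / (m + o) := by rw [← hmo']; field_simp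
    _ ≤ π ^ 4 * ((j : ℝ) + 1) ^ 4 / (m + 1) := by gcongr
    _ = 3 * (π ^ 4 * ((j : ℝ) + 1) ^ 4 / (3 * (m + 1))) := by field_simp
    _ ≤ _ := by gcongr

/-- Termwise, since o(M+1) = m+o ≤ 2(m+1); then 6 = 2·3. -/
theorem noiseAmp_le_div (ho : 1 ≤ o) (hM : 1 ≤ M) (hmo : M * o = m) {k : ℕ} (hk : k ≤ M) :
    noiseAmp m k ≤ 6 * (1 / (o : ℝ) * noiseAmp M k) := by
  have ho' : (1 : ℝ) ≤ o := by exact_mod_cast ho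
  have hM' : (1 : ℝ) ≤ M := by exact_mod_cast hM
  have hmo' : (M : ℝ) * o = m := by exact_mod_cast hmo
  have hom : (o : ℝ) ≤ m := by nlinarith
  rw [noiseAmp, noiseAmp, Finset.mul_sum, Finset.mul_sum]
  refine Finset.sum_le_sum fun j hj => ?_
  have hjk := Finset.mem_range.1 hj
  have h1 := one_div_gridEig_le m j
  have h2 := le_one_div_gridEig (n := M) (j := j) (by omega)
  calc _ ≤ π ^ 4 * ((j : ℝ) + 1) ^ 4 / ((m : ℝ) + 1) := h1
    _ = 2 * (π ^ 4 * ((j : ℝ) + 1) ^ 4) / (2 * (m + 1)) := by field_simp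
    _ ≤ 2 * (π ^ 4 * ((j : ℝ) + 1) ^ 4) / (m + o) := by gcongr; linarith
    _ = 6 * (1 / (o : ℝ) * (π ^ 4 * ((j : ℝ) + 1) ^ 4 / (3 * (M + 1)))) := by
      rw [← hmo']; field_simp; ring
    _ ≤ _ := by gcongr

/-- For averages over at least two data the noise level is bounded below. -/
theorem sq_le_of_le_max_sqrt (hρ : 0 < ρ) (ho : 2 ≤ o)
    (h : (o : ℝ) ≤ max (√(((m : ℝ) + 1) * δ ^ 2 / ρ ^ 2)) 1) :
    (o : ℝ) ^ 2 * ρ ^ 2 ≤ ((m : ℝ) + 1) * δ ^ 2 := by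
  have ho' : (2 : ℝ) ≤ o := by exact_mod_cast ho
  have h1 : (o : ℝ) ≤ √(((m : ℝ) + 1) * δ ^ 2 / ρ ^ 2) :=
    (le_max_iff.1 h).resolve_right (by linarith)
  have h2 := (le_sqrt (by linarith) (by positivity)).1 h1
  rwa [le_div_iff₀ (by positivity)] at h2

/-- The left side dominates the averaging bias. Admissibility trades o²ρ² for (m+1)δ², leaving three
times the lower bound for the last noise term. -/
theorem sq_mul_le_noise (hδ : (o : ℝ) ^ 2 * ρ ^ 2 ≤ ((m : ℝ) + 1) * δ ^ 2) {k : ℕ} (hk : k ≤ m) :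
    π ^ 4 * (k : ℝ) ^ 4 * ((o : ℝ) / ((m : ℝ) + 1)) ^ 2 * ρ ^ 2 ≤ 3 * (δ ^ 2 * noiseAmp m k) := by
  rcases Nat.eq_zero_or_pos k with rfl | hk0
  · have := noiseAmp_nonneg m 0
    simp only [Nat.cast_zero]
    rw [show (0 : ℝ) ^ 4 = 0 by norm_num]
    simp only [mul_zero, zero_mul]
    positivity
  have hm : (0 : ℝ) < (m : ℝ) + 1 := by positivity
  calc _ = π ^ 4 * (k : ℝ) ^ 4 / ((m : ℝ) + 1) ^ 2 * ((o : ℝ) ^ 2 * ρ ^ 2) := by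
        field_simp
    _ ≤ π ^ 4 * (k : ℝ) ^ 4 / ((m : ℝ) + 1) ^ 2 * (((m : ℝ) + 1) * δ ^ 2) := by gcongr
    _ = 3 * (δ ^ 2 * (π ^ 4 * (k : ℝ) ^ 4 / (3 * ((m : ℝ) + 1)))) := by field_simp
    _ ≤ _ := by
      have := le_noiseAmp hk0 hk
      gcongr

theorem one_div_le_block_div (ho : 1 ≤ o) (hmo : M * o = m) :
    1 / ((M : ℝ) + 1) ≤ (o : ℝ) / ((m : ℝ) + 1) := by
  have ho' : (1 : ℝ) ≤ o := by exact_mod_cast ho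
  have hmo' : (M : ℝ) * o = m := by exact_mod_cast hmo
  rw [div_le_div_iff₀ (by positivity) (by positivity)]
  linarith

/-- Here 27 = 81/3 comes from π⁴ ≥ 3⁴. It serves to absorb the alias term, and ‖f‖² itself when k >
M. -/
theorem sq_div_sq_le_noise (ho : 1 ≤ o) (hmo : M * o = m)
    (hδ : (o : ℝ) ^ 2 * ρ ^ 2 ≤ ((m : ℝ) + 1) * δ ^ 2) {k : ℕ} (hk : k ≤ m) :
    27 * ((k : ℝ) ^ 4 * (1 / ((M : ℝ) + 1)) ^ 2 * ρ ^ 2) ≤ δ ^ 2 * noiseAmp m k := by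
  have h := sq_mul_le_noise hδ hk
  have hpi : (81 : ℝ) ≤ π ^ 4 := by
    have := pow_le_pow_left₀ (by norm_num) pi_gt_three.le 4
    norm_num at this
    exact this
  have h2 : 81 * (k : ℝ) ^ 4 * (1 / ((M : ℝ) + 1)) ^ 2 * ρ ^ 2 ≤
      π ^ 4 * (k : ℝ) ^ 4 * ((o : ℝ) / ((m : ℝ) + 1)) ^ 2 * ρ ^ 2 := by
    have := one_div_le_block_div ho hmo
    gcongr
  linarith

theorem pi_rpow_neg_le_one (hs : 0 < s) : π ^ (-(4 * s)) ≤ 1 :=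
  rpow_le_one_of_one_le_of_nonpos (by linarith [pi_gt_three]) (by linarith)

/-- For k ≥ 1 the alias term of `tailSq_le` is hidden in the noise; for k = 0 the tail is just ‖f‖².
Both n = m and n = M are needed. -/
theorem tailSq_le_add_noise (hs : 0 < s) (ho : 1 ≤ o) (hmo : M * o = m)
    (hδ : (o : ℝ) ^ 2 * ρ ^ 2 ≤ ((m : ℝ) + 1) * δ ^ 2) {n k : ℕ} (hMn : M ≤ n) (hkn : k ≤ n)
    (hkm : k ≤ m) {f : L2} (hf : f ∈ sourceSet s ρ) :
    tailSq n k f ≤ 6 * (ρ ^ 2 * π ^ (-(4 * s)) * ((k : ℝ) + 1) ^ (-(4 * s))) +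
      δ ^ 2 * noiseAmp m k := by
  rcases Nat.eq_zero_or_pos k with rfl | hk0
  · have h1 := norm_sq_le_of_mem_sourceSet hs hf
    have h2 : 0 ≤ ρ ^ 2 * π ^ (-(4 * s)) := by positivity
    have h3 := noiseAmp_nonneg m 0
    have h4 : 0 ≤ δ ^ 2 * noiseAmp m 0 := by positivity
    simp [tailSq]
    linarith
  have h1 := sq_div_sq_le_noise ho hmo hδ hkm
  have hk1 : (1 : ℝ) ≤ k := by exact_mod_cast hk0
  have hMn' : (M : ℝ) ≤ n := by exact_mod_cast hMn
  have h2 : 4 * (ρ ^ 2 * π ^ (-(4 * s)) / ((n : ℝ) + 1) ^ 4) ≤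
      27 * ((k : ℝ) ^ 4 * (1 / ((M : ℝ) + 1)) ^ 2 * ρ ^ 2) := by
    have h3 : ((M : ℝ) + 1) ^ 2 ≤ ((n : ℝ) + 1) ^ 4 :=
      calc ((M : ℝ) + 1) ^ 2 ≤ ((n : ℝ) + 1) ^ 2 := by gcongr
        _ ≤ _ := pow_le_pow_right₀ (by linarith [Nat.cast_nonneg (α := ℝ) n]) (by norm_num)
    calc 4 * (ρ ^ 2 * π ^ (-(4 * s)) / ((n : ℝ) + 1) ^ 4)
        ≤ 27 * (ρ ^ 2 * 1 / ((M : ℝ) + 1) ^ 2) := by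
          gcongr
          · norm_num
          · exact pi_rpow_neg_le_one hs
      _ = 27 * (1 ^ 4 * (1 / ((M : ℝ) + 1)) ^ 2 * ρ ^ 2) := by field_simp
      _ ≤ _ := by gcongr
  refine (tailSq_le hs hkn hf).trans ?_
  have h4 : 2 * ρ ^ 2 * π ^ (-(4 * s)) *
      (3 * ((k : ℝ) + 1) ^ (-(4 * s)) + 2 / ((n : ℝ) + 1) ^ 4) =
      6 * (ρ ^ 2 * π ^ (-(4 * s)) * ((k : ℝ) + 1) ^ (-(4 * s))) +
        4 * (ρ ^ 2 * π ^ (-(4 * s)) / ((n : ℝ) + 1) ^ 4) := by ring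
  rw [h4]
  linarith

theorem le_of_admissible (hm : 1 ≤ m) (ho : o ∈ admissibleBlocks m δ ρ) :
    1 ≤ o ∧ 1 ≤ m / o ∧ m / o * o = m := by
  have h1 : o ≠ 0 := fun h => by
    have := ho.2
    rw [h, zero_dvd_iff] at this
    omega
  have h2 := Nat.div_mul_cancel ho.2
  refine ⟨Nat.one_le_iff_ne_zero.2 h1, Nat.one_le_iff_ne_zero.2 fun h => ?_, h2⟩
  rw [h, zero_mul] at h2
  omega

/-- For k ≤ m/o the same cut-off works: the tail costs 6 tails of `f₀` plus one noise, variance and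
bias cost 3 noises each, and 7 = 1 + 3 + 3. For larger k the zero estimator suffices. `β` stands for
the squared bias. -/
theorem exists_mse_averaged_le (hs : 0 < s) (hρ : 0 < ρ) (hm : 1 ≤ m)
    (ho : o ∈ admissibleBlocks m δ ρ) {β : ℕ → L2 → ℝ}
    (hβ : ∀ k f, β k f ≤ π ^ 4 * (k : ℝ) ^ 4 * (((o : ℝ) - 1) / ((m : ℝ) + 1)) ^ 2 * ‖f‖ ^ 2)
    {k : ℕ} (hk : k ≤ m) :
    ∃ k' ≤ m / o, ∀ f ∈ sourceSet s ρ, ∃ f₀ ∈ sourceSet s ρ,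
      mse (m / o) k' (δ ^ 2 / o) f + β k' f ≤ 7 * mse m k (δ ^ 2) f₀ := by
  obtain ⟨ho1, hM, hmo⟩ := le_of_admissible hm ho
  have hV : 0 ≤ δ ^ 2 * noiseAmp m k := mul_nonneg (sq_nonneg _) (noiseAmp_nonneg m k)
  set f₀ := (ρ * lam k ^ s) • sineL2 k with hf₀
  have hf₀X : f₀ ∈ sourceSet s ρ := smul_sineL2_mem_sourceSet s hρ k
  have hT : tailSq m k f₀ = ρ ^ 2 * π ^ (-(4 * s)) * ((k : ℝ) + 1) ^ (-(4 * s)) :=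
    tailSq_smul_sineL2 s ρ hk
  have hT0 : 0 ≤ tailSq m k f₀ := by rw [hT]; positivity
  -- For o = 1 the admissibility condition carries no information on δ, but then the bias bound is 0
  -- and both risks agree.
  rcases ho1.eq_or_lt with rfl | ho2
  · refine ⟨k, by rwa [Nat.div_one], fun f hf => ?_⟩
    have h1 := hβ k f
    have h2 : 0 ≤ mse m k (δ ^ 2) f := add_nonneg (tailSq_nonneg hk f) hV
    refine ⟨f, hf, ?_⟩
    rw [Nat.div_one, Nat.cast_one, div_one]
    simp only [Nat.cast_one, sub_self, zero_div] at h1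
    norm_num at h1
    linarith
  have hδ := sq_le_of_le_max_sqrt hρ ho2 ho.1
  rcases le_or_gt k (m / o) with hkM | hkM
  · refine ⟨k, hkM, fun f hf => ⟨f₀, hf₀X, ?_⟩⟩
    have h1 := tailSq_le_add_noise hs ho1 hmo hδ le_rfl hkM hk hf
    rw [← hT] at h1
    have h2 : δ ^ 2 / o * noiseAmp (m / o) k ≤ 3 * (δ ^ 2 * noiseAmp m k) := by
      have := mul_le_mul_of_nonneg_left (div_noiseAmp_le ho1 hmo hkM) (sq_nonneg δ)
      calc _ = δ ^ 2 * (1 / (o : ℝ) * noiseAmp (m / o) k) := by ring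
        _ ≤ _ := this
        _ = _ := by ring
    have h3 : β k f ≤ 3 * (δ ^ 2 * noiseAmp m k) := by
      refine (hβ k f).trans (le_trans ?_ (sq_mul_le_noise hδ hk))
      have h4 : ‖f‖ ^ 2 ≤ ρ ^ 2 := (norm_sq_le_of_mem_sourceSet hs hf).trans
        (mul_le_of_le_one_right (sq_nonneg ρ) (pi_rpow_neg_le_one hs))
      have h5 : (0 : ℝ) ≤ (o : ℝ) - 1 := by
        have : (1 : ℝ) ≤ o := by exact_mod_cast ho1
        linarith
      gcongr
      linarith
    unfold mse
    linarith
  · refine ⟨0, Nat.zero_le _, fun f hf => ⟨f₀, hf₀X, ?_⟩⟩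
    have h1 := hβ 0 f
    have h2 := norm_sq_le_of_mem_sourceSet hs hf
    have h3 := sq_div_sq_le_noise ho1 hmo hδ hk
    have h4 : ((m / o : ℕ) : ℝ) + 1 ≤ k := by exact_mod_cast hkM
    have h5 : ρ ^ 2 * π ^ (-(4 * s)) ≤
        27 * ((k : ℝ) ^ 4 * (1 / (((m / o : ℕ) : ℝ) + 1)) ^ 2 * ρ ^ 2) := by
      have hM0 : (0 : ℝ) < ((m / o : ℕ) : ℝ) + 1 := by positivity
      have h6 : 1 ≤ (k : ℝ) ^ 4 * (1 / (((m / o : ℕ) : ℝ) + 1)) ^ 2 := by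
        rw [one_div, inv_pow, ← div_eq_mul_inv, one_le_div (by positivity)]
        calc (((m / o : ℕ) : ℝ) + 1) ^ 2 ≤ (k : ℝ) ^ 2 := by gcongr
          _ ≤ _ := pow_le_pow_right₀ (by linarith [Nat.cast_nonneg (α := ℝ) (m / o)]) (by norm_num)
      have h7 : ρ ^ 2 ≤ (k : ℝ) ^ 4 * (1 / (((m / o : ℕ) : ℝ) + 1)) ^ 2 * ρ ^ 2 :=
        le_mul_of_one_le_left (sq_nonneg ρ) h6
      have h8 := mul_le_of_le_one_right (sq_nonneg ρ) (pi_rpow_neg_le_one hs)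
      have h9 := sq_nonneg ρ
      linarith
    simp only [Nat.cast_zero] at h1
    norm_num at h1
    rw [mse_zero]
    unfold mse
    linarith

/-- Tail and alias term cost 6 tails of the witness and one noise; together with the noise itself
this makes two full-data noises, each at most 6 averaged ones, and 12 = 2·6. The bias is simply
dropped. -/
theorem exists_mse_le_averaged (hs : 0 < s) (hρ : 0 < ρ) (hm : 1 ≤ m)
    (ho : o ∈ admissibleBlocks m δ ρ) {k : ℕ} (hkM : k ≤ m / o) :
    ∀ f ∈ sourceSet s ρ, ∃ f₀ ∈ sourceSet s ρ,
      mse m k (δ ^ 2) f ≤ 12 * mse (m / o) k (δ ^ 2 / o) f₀ := by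
  obtain ⟨ho1, hM, hmo⟩ := le_of_admissible hm ho
  have hk : k ≤ m := hkM.trans (Nat.div_le_self m o)
  intro f hf
  rcases ho1.eq_or_lt with rfl | ho2
  · have hV : 0 ≤ δ ^ 2 * noiseAmp m k := mul_nonneg (sq_nonneg _) (noiseAmp_nonneg m k)
    have h2 : 0 ≤ mse m k (δ ^ 2) f := add_nonneg (tailSq_nonneg hk f) hV
    refine ⟨f, hf, ?_⟩
    rw [Nat.div_one, Nat.cast_one, div_one]
    linarith
  have hδ := sq_le_of_le_max_sqrt hρ ho2 ho.1
  refine ⟨(ρ * lam k ^ s) • sineL2 k, smul_sineL2_mem_sourceSet s hρ k, ?_⟩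
  have h1 := tailSq_le_add_noise hs ho1 hmo hδ (Nat.div_le_self m o) hk hk hf
  have h2 : δ ^ 2 * noiseAmp m k ≤ 6 * (δ ^ 2 / o * noiseAmp (m / o) k) := by
    have := mul_le_mul_of_nonneg_left (noiseAmp_le_div ho1 hM hmo hkM) (sq_nonneg δ)
    calc _ ≤ _ := this
      _ = _ := by ring
  have h3 : 0 ≤ ρ ^ 2 * π ^ (-(4 * s)) * ((k : ℝ) + 1) ^ (-(4 * s)) := by positivity
  unfold mse
  rw [tailSq_smul_sineL2 s ρ hkM]
  linarith

end Comparison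

/-! ### Numerical constants and passage to suprema and infima -/

theorem seven_le_const {s : ℝ} (hs : 0 < s) : 7 ≤ 15 * π ^ (4 * s + 8) / 16 := by
  have hpi : (1 : ℝ) ≤ π := by linarith [pi_gt_three]
  have h1 : (3 : ℝ) ^ 8 ≤ π ^ 8 := pow_le_pow_left₀ (by norm_num) pi_gt_three.le 8
  have h2 : π ^ 8 ≤ π ^ (4 * s + 8) := by
    rw [← rpow_natCast]
    exact rpow_le_rpow_of_exponent_le hpi (by push_cast; linarith)
  norm_num at h1
  linarith

theorem const_le_one_div_twelve {s : ℝ} (hs : 0 < s) :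
    16 / (π ^ (4 * s + 4) * (3 * π ^ 4 + 1 / 2)) ≤ 1 / 12 := by
  have hpi : (1 : ℝ) ≤ π := by linarith [pi_gt_three]
  have h1 : (3 : ℝ) ^ 4 ≤ π ^ 4 := pow_le_pow_left₀ (by norm_num) pi_gt_three.le 4
  have h2 : 1 ≤ π ^ (4 * s + 4) := one_le_rpow hpi (by linarith)
  norm_num at h1
  rw [div_le_div_iff₀ (by positivity) (by norm_num)]
  nlinarith

theorem ofReal_mul_le_of_le_mul {a : ℝ} (ha : a ≤ 1 / 12) {x y : ℝ≥0∞}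
    (h : x ≤ ENNReal.ofReal 12 * y) : ENNReal.ofReal a * x ≤ y := by
  calc _ ≤ ENNReal.ofReal (1 / 12) * (ENNReal.ofReal 12 * y) :=
        mul_le_mul' (ENNReal.ofReal_le_ofReal ha) h
    _ = y := by
      rw [← mul_assoc, ← ENNReal.ofReal_mul (by norm_num)]
      norm_num

theorem iSup_ofReal_le {X : Set L2} {F G : L2 → ℝ} {C : ℝ} (hC : 0 ≤ C)
    (h : ∀ f ∈ X, ∃ f₀ ∈ X, F f ≤ C * G f₀) :
    ⨆ f ∈ X, ENNReal.ofReal (F f) ≤ ENNReal.ofReal C * ⨆ f ∈ X, ENNReal.ofReal (G f) := by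
  refine iSup₂_le fun f hf => ?_
  obtain ⟨f₀, hf₀, hle⟩ := h f hf
  calc _ ≤ ENNReal.ofReal (C * G f₀) := ENNReal.ofReal_le_ofReal hle
    _ = ENNReal.ofReal C * ENNReal.ofReal (G f₀) := ENNReal.ofReal_mul hC
    _ ≤ _ := by
      gcongr
      exact le_iSup₂_of_le (f := fun f _ => ENNReal.ofReal (G f)) f₀ hf₀ le_rfl

theorem err_eq {Ω : Type*} [MeasurableSpace Ω] {P : Measure Ω} [IsProbabilityMeasure P] {m : ℕ}
    {Z : Fin m → Ω → ℝ} (hZ2 : ∀ l, MemLp (Z l) 2 P) (hZ_mean : ∀ i, ∫ ω, Z i ω ∂P = 0)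
    (hZ : ∀ l l', ∫ ω, Z l ω * Z l' ω ∂P = if l = l' then 1 else 0)
    {v : Fin m → L2} {u : Fin m → EuclideanSpace ℝ (Fin m)} {σ : Fin m → ℝ}
    (h : IsSVD (Km m) v u σ) (δ s ρ : ℝ) :
    err P Z v u σ δ s ρ =
      ⨅ k : Fin (m + 1), ⨆ f ∈ sourceSet s ρ, ENNReal.ofReal (mse m k (δ ^ 2) f) := by
  unfold err
  refine iInf_congr fun k => iSup_congr fun f => iSup_congr fun _ => ?_
  simp only [noisyData_eq]
  rw [h.lintegral_error (τ := δ ^ 2) (Nat.lt_succ_iff.1 k.2) (fun l => (hZ2 l).const_mul δ)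
    (fun l => by rw [integral_const_mul, hZ_mean, mul_zero]), biasSq_zero, add_zero, mse]
  intro l l'
  have h2 : ∀ ω, δ * Z l ω * (δ * Z l' ω) = δ ^ 2 * (Z l ω * Z l' ω) := fun ω => by ring
  simp only [h2]
  rw [integral_const_mul, hZ, mul_ite, mul_one, mul_zero]

theorem errAveraged_eq {Ω : Type*} [MeasurableSpace Ω] {P : Measure Ω} [IsProbabilityMeasure P]
    {m o : ℕ} {Z : Fin m → Ω → ℝ} (hZ2 : ∀ l, MemLp (Z l) 2 P)
    (hZ_mean : ∀ i, ∫ ω, Z i ω ∂P = 0)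
    (hZ : ∀ l l', ∫ ω, Z l ω * Z l' ω ∂P = if l = l' then 1 else 0)
    {v : Fin (m / o) → L2} {u : Fin (m / o) → EuclideanSpace ℝ (Fin (m / o))}
    {σ : Fin (m / o) → ℝ} (h : IsSVD (Km (m / o)) v u σ) (δ s ρ : ℝ) :
    errAveraged P Z o v u σ δ s ρ =
      ⨅ k : Fin (m / o + 1), ⨆ f ∈ sourceSet s ρ,
        ENNReal.ofReal (mse (m / o) k (δ ^ 2 / o) f + biasSq u σ k (avgBias m o f)) := by
  unfold errAveraged
  refine iInf_congr fun k => iSup_congr fun f => iSup_congr fun _ => ?_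
  simp only [blockAverage_noisyData_eq]
  rw [h.lintegral_error (τ := δ ^ 2 / o) (Nat.lt_succ_iff.1 k.2)
    (W := fun i ω => ∑ j, δ / o * Z (blockIdx i j) ω)
    (fun i => memLp_finsetSum _ fun j _ => (hZ2 (blockIdx i j)).const_mul (δ / o))
    (fun i => ?_) (integral_blockSum_mul hZ2 hZ δ), mse, add_right_comm]
  rw [integral_finsetSum _ fun j _ =>
    ((hZ2 (blockIdx i j)).const_mul (δ / o)).integrable one_le_two]
  simp [integral_const_mul, hZ_mean]

end AveragedData

theorem theoremt2 {Ω : Type*} [MeasurableSpace Ω] (P : MeasureTheory.Measure Ω)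
    [MeasureTheory.IsProbabilityMeasure P]
    (m : ℕ) (hm : 1 ≤ m) (δ s ρ : ℝ) (hδ : 0 < δ) (hs : 3 / 4 < s) (hρ : 0 < ρ)
    (Z : Fin m → Ω → ℝ)
    (hZ_indep : ProbabilityTheory.iIndepFun Z P)
    (hZ_ident : ∀ i j, ProbabilityTheory.IdentDistrib (Z i) (Z j) P P)
    (hZ_mean : ∀ i, ∫ ω, Z i ω ∂P = 0)
    (hZ_var : ∀ i, ∫ ω, Z i ω ^ 2 ∂P = 1)
    (o : ℕ) (ho : o ∈ AveragedData.admissibleBlocks m δ ρ)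
    (v : Fin m → AveragedData.L2) (u : Fin m → EuclideanSpace ℝ (Fin m)) (σ : Fin m → ℝ)
    (hsvd : AveragedData.IsSVD (AveragedData.Km m) v u σ)
    (v' : Fin (m / o) → AveragedData.L2) (u' : Fin (m / o) → EuclideanSpace ℝ (Fin (m / o)))
    (σ' : Fin (m / o) → ℝ)
    (hsvd' : AveragedData.IsSVD (AveragedData.Km (m / o)) v' u' σ') :
    ENNReal.ofReal (16 / (Real.pi ^ (4 * s + 4) * (3 * Real.pi ^ 4 + 1 / 2))) *
        AveragedData.err P Z v u σ δ s ρ ≤ AveragedData.errAveraged P Z o v' u' σ' δ s ρ ∧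
      AveragedData.errAveraged P Z o v' u' σ' δ s ρ ≤
        ENNReal.ofReal (15 * Real.pi ^ (4 * s + 8) / 16) *
          AveragedData.err P Z v u σ δ s ρ := by
  have hs0 : 0 < s := by linarith
  have hZ2 := AveragedData.memLp_of_integral_sq_eq_one hZ_ident hZ_var
  have hZ := AveragedData.integral_mul_eq_ite hZ_indep hZ_ident hZ_mean hZ_var
  rw [AveragedData.err_eq hZ2 hZ_mean hZ hsvd, AveragedData.errAveraged_eq hZ2 hZ_mean hZ hsvd']
  constructor
  -- Every cut-off for the averaged data is also available for the full data, because k ≤ m/o ≤ m.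
  · refine le_iInf fun k => ?_
    have hk : (k : ℕ) ≤ m / o := Nat.lt_succ_iff.1 k.2
    have hkm : (k : ℕ) < m + 1 := Nat.lt_succ_iff.2 (hk.trans (Nat.div_le_self m o))
    have h1 := AveragedData.iSup_ofReal_le (X := AveragedData.sourceSet s ρ)
      (F := AveragedData.mse m k (δ ^ 2))
      (G := fun f => AveragedData.mse (m / o) k (δ ^ 2 / o) f +
        AveragedData.biasSq u' σ' k (AveragedData.avgBias m o f)) (C := 12) (by norm_num)
      fun f hf => by
        obtain ⟨f₀, hf₀, hle⟩ := AveragedData.exists_mse_le_averaged hs0 hρ hm ho hk f hf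
        have := AveragedData.biasSq_nonneg u' σ' k (AveragedData.avgBias m o f₀)
        exact ⟨f₀, hf₀, by linarith⟩
    exact AveragedData.ofReal_mul_le_of_le_mul (AveragedData.const_le_one_div_twelve hs0)
      ((iInf_le (fun k : Fin (m + 1) => ⨆ f ∈ AveragedData.sourceSet s ρ,
        ENNReal.ofReal (AveragedData.mse m k (δ ^ 2) f)) ⟨k, hkm⟩).trans h1)
  -- A factor that is neither 0 nor ∞ moves inside the infimum, so each full-data cut-off can be
  -- matched separately.
  · rw [ENNReal.mul_iInf_of_ne (ENNReal.ofReal_pos.2 (by positivity)).ne' ENNReal.ofReal_ne_top]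
    refine le_iInf fun k => ?_
    obtain ⟨k', hk', h⟩ := AveragedData.exists_mse_averaged_le hs0 hρ hm ho
      (β := fun k f => AveragedData.biasSq u' σ' k (AveragedData.avgBias m o f))
      (fun k f => hsvd'.biasSq_avgBias_le (AveragedData.le_of_admissible hm ho).1 ho.2 k f)
      (Nat.lt_succ_iff.1 k.2)
    exact iInf_le_of_le ⟨k', Nat.lt_succ_iff.2 hk'⟩
      ((AveragedData.iSup_ofReal_le (by norm_num) h).trans
        (mul_le_mul_left (ENNReal.ofReal_le_ofReal (AveragedData.seven_le_const hs0)) _))
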